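/- Let nodes be distributed as a homogeneous Poisson point process of density $\lambda>0$ on a planar region $\mathcal A$ of finite area, and let $\mathcal A_\mu\subseteq\mathcal A$ be the disk of radius $R>0$ covered by a drone hovering at altitude $h>0$ above its centre; put $d=\sqrt{h^2+R^2}$. Independently of everything else, each node transmits with probability $a\in[0,1]$ (slotted ALOHA), and its signal has a power gain $G_x$; the gains are i.i.d. and Gamma distributed with density $f_G(g)=\frac{m^m g^{m-1}}{\Gamma(m)}e^{-mg}$, $g\ge 0$ (Nakagami-$m$ fading, $m$ a positive integer). Let $\tilde\Psi_\mu$ be the set of transmitting nodes in $\mathcal A_\mu$, $D_x\in[h,d]$ the distance from node $x$ to the drone, $\eta>0$ the path-loss exponent, $P>0$ the transmission power and $\sigma_n^2>0$ the noise variance. For $x_n\in\tilde\Psi_\mu$ put $$\mathrm{SINR}^n_\mu=\frac{P\,G_{x_n}D_{x_n}^{-\eta}}{\sum_{x\in\tilde\Psi_\mu\setminus\{x_n\}}P\,G_xD_x^{-\eta}+\sigma_n^2},\qquad I_n=\sum_{x\in\tilde\Psi_\mu\setminus\{x_n\}}G_xD_x^{-\eta}+\frac{\sigma_n^2}{P}.$$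 Then, for every SINR threshold $\beta\ge 1$, the success probability is $$P^s_\mu=\mathbb P\Big(\bigcup_{x_n\in\tilde\Psi_\mu}\{\mathrm{SINR}^n_\mu\ge\beta\}\Big)=\mathbb E\Big[\sum_{x_n\in\tilde\Psi_\mu}\mathbf 1_{\{\mathrm{SINR}^n_\mu\ge\beta\}}\Big]=2a\pi\lambda\int_h^d\sum_{k=0}^{m-1}\frac{(-m\beta r^\eta)^k}{k!}\Big[\frac{\partial^k}{\partial s^k}\mathcal L_I(s)\Big]_{s=m\beta r^\eta}r\,dr,$$ where $$\mathcal L_I(s)=e^{-s\sigma_n^2/P}\exp\Big(-2\pi\lambda a\int_h^d\Big(1-\Big(1+\frac{s\,r^{-\eta}}{m}\Big)^{-m}\Big)r\,dr\Big).$$ Moreover, for $s\ge 0$, $\mathcal L_I(s)$ is the Laplace transform of the distribution of the normalized interference-plus-noise power seen by a transmitting node: there is a probability law $Q$ on $\mathbb R$ such that for all Borel sets $B\subseteq\mathbb R^2$ and $C\subseteq\mathbb R$ $$\mathbb E\big[\#\{x_n\in\tilde\Psi_\mu: x_n\in B,\ I_n\in C\}\big]=\mathbb E\big[\#\{x_n\in\tilde\Psi_\mu:x_n\in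 B\}\big]\,Q(C),$$ and $\int e^{-sy}\,Q(dy)=\mathcal L_I(s)$. -/

import Mathlib

open MeasureTheory ProbabilityTheory

/-- The ground plane. -/
abbrev Plane : Type := EuclideanSpace ℝ (Fin 2)

/-- A random finite field of nodes on the plane: the nodes are those of index `n < card ω`; node `n`
sits at `pos n ω`, transmits in the current slot iff `tx n ω = true`, and has power gain
`gain n ω`. -/
structure NodeField (Ω : Type*) where
  card : Ω → ℕ
  pos : ℕ → Ω → Plane
  tx : ℕ → Ω → Bool
  gain : ℕ → Ω → ℝ

namespace NodeField

variable {Ω : Type*}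

open Classical in
/-- Number of nodes (transmitting or not) located in `B`. -/
noncomputable def count (F : NodeField Ω) (B : Set Plane) (ω : Ω) : ℕ :=
  ((Finset.range (F.card ω)).filter (fun n => F.pos n ω ∈ B)).card

open Classical in
/-- The transmitting nodes located in `B`. -/
noncomputable def active (F : NodeField Ω) (B : Set Plane) (ω : Ω) : Finset ℕ :=
  (Finset.range (F.card ω)).filter (fun n => F.pos n ω ∈ B ∧ F.tx n ω = true)

/-- The node positions form a homogeneous Poisson point process of density `lam` on the region `A`:
the number of nodes in a Borel set `B ⊆ A` is Poisson with mean `lam * |B|`, and the numbers of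
nodes in pairwise disjoint Borel sets are independent. -/
structure IsHomogeneousPPP [MeasurableSpace Ω] (F : NodeField Ω) (μ : Measure Ω)
    (A : Set Plane) (lam : ℝ) : Prop where
  measurable_card : Measurable F.card
  measurable_pos : ∀ n, Measurable (F.pos n)
  mem_region : ∀ᵐ ω ∂μ, ∀ n < F.card ω, F.pos n ω ∈ A
  poisson_count : ∀ B ⊆ A, MeasurableSet B →
    HasLaw (F.count B) (poissonMeasure (lam * volume.real B).toNNReal) μ
  indep_count : ∀ (k : ℕ) (B : Fin k → Set Plane), (∀ j, B j ⊆ A) → (∀ j, MeasurableSet (B j)) →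
    Pairwise (fun i j => Disjoint (B i) (B j)) → iIndepFun (fun j => F.count (B j)) μ

/-- Slotted ALOHA with transmission probability `a` and Nakagami-`m` fading: the node positions, the
transmission decisions and the gains are independent of one another, the decisions are i.i.d.
Bernoulli(`a`) and the gains are i.i.d. Gamma of shape `m` and rate `m`. -/
structure HasAlohaNakagamiMarks [MeasurableSpace Ω] (F : NodeField Ω) (μ : Measure Ω)
    (a : ℝ) (m : ℕ) : Prop where
  measurable_tx : ∀ n, Measurable (F.tx n)
  measurable_gain : ∀ n, Measurable (F.gain n)
  tx_prob : ∀ n, μ {ω | F.tx n ω = true} = ENNReal.ofReal a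
  gain_law : ∀ n, HasLaw (F.gain n) (gammaMeasure m m) μ
  indep_tx_gain : ∀ n, IndepFun (F.tx n) (F.gain n) μ
  iIndep_marks : iIndepFun (fun n ω => (F.tx n ω, F.gain n ω)) μ
  indep_pos_marks : IndepFun (fun ω => (F.card ω, fun n => F.pos n ω))
    (fun ω n => (F.tx n ω, F.gain n ω)) μ

/-- The circular region covered from the hovering location above `c`. -/
def coverage (c : Plane) (R : ℝ) : Set Plane := Metric.closedBall c R

/-- Distance between the ground point `x` and the drone at altitude `h` above `c`. -/
noncomputable def droneDist (c : Plane) (h : ℝ) (x : Plane) : ℝ :=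
  Real.sqrt (‖x - c‖ ^ 2 + h ^ 2)

/-- SINR at the drone of node `n`, all other transmitting nodes of the covered region being
interferers; `P` is the transmission power, `noise` the noise variance. -/
noncomputable def sinr (F : NodeField Ω) (c : Plane) (R h η P noise : ℝ) (n : ℕ) (ω : Ω) : ℝ :=
  P * F.gain n ω * droneDist c h (F.pos n ω) ^ (-η) /
    ((∑ j ∈ (F.active (coverage c R) ω).erase n,
      P * F.gain j ω * droneDist c h (F.pos j ω) ^ (-η)) + noise)

/-- Normalized interference-plus-noise power seen by node `n`. -/
noncomputable def interference (F : NodeField Ω) (c : Plane) (R h η P noise : ℝ) (n : ℕ)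
    (ω : Ω) : ℝ :=
  (∑ j ∈ (F.active (coverage c R) ω).erase n,
    F.gain j ω * droneDist c h (F.pos j ω) ^ (-η)) + noise / P

/-- The event that some transmission from the covered region succeeds. -/
def successEvent (F : NodeField Ω) (c : Plane) (R h η P noise β : ℝ) : Set Ω :=
  {ω | ∃ n ∈ F.active (coverage c R) ω, β ≤ F.sinr c R h η P noise n ω}

open Classical in
/-- The number of successful transmissions. -/
noncomputable def successCount (F : NodeField Ω) (c : Plane) (R h η P noise β : ℝ) (ω : Ω) : ℝ :=
  ∑ n ∈ F.active (coverage c R) ω, if β ≤ F.sinr c R h η P noise n ω then 1 else 0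

open Classical in
/-- `Q` is the distribution of the interference-plus-noise power seen by a transmitting node,
whatever its position (Palm distribution): the expected number of transmitting nodes in `B` whose
interference lies in `C` is `Q C` times the expected number of transmitting nodes in `B`. -/
def IsInterferenceLaw [MeasurableSpace Ω] (F : NodeField Ω) (μ : Measure Ω) (c : Plane)
    (R h η P noise : ℝ) (Q : Measure ℝ) : Prop :=
  IsProbabilityMeasure Q ∧
  ∀ (B : Set Plane) (C : Set ℝ), MeasurableSet B → MeasurableSet C →
    ∫⁻ ω, (((F.active (coverage c R) ω).filter (fun n =>
        F.pos n ω ∈ B ∧ F.interference c R h η P noise n ω ∈ C)).card : ENNReal) ∂μ =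
      (∫⁻ ω, (((F.active (coverage c R) ω).filter (fun n => F.pos n ω ∈ B)).card : ENNReal) ∂μ)
        * Q C

end NodeField

/-- The function `L_I(s)`. -/
noncomputable def laplaceI (lam a η P noise h d : ℝ) (m : ℕ) (s : ℝ) : ℝ :=
  Real.exp (-s * noise / P) *
    Real.exp (-2 * Real.pi * lam * a *
      ∫ r in h..d, (1 - (1 + s * r ^ (-η) / m) ^ (-(m : ℤ))) * r)

/-! When `β ≥ 1`, two transmissions cannot both succeed: each received power would have to exceed
the other one plus a positive noise. Hence the indicator of success is almost surely the number of
successes, and the success probability is the mean of a sum over the points of a marked Poisson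
process. Success of a node at distance `r` reads `G ≥ β r ^ η I`, with `I` its interference plus
noise. By Slivnyak–Mecke (`campbell_eq_prod`) the mean is the integral over the disk of `lam * a *
ℙ(G ≥ β r ^ η I)`, where `I` is independent of `G` and distributed as the shot noise of all
transmitters plus `noise / P`. For integer `m` the gamma tail is an exponential times a polynomial,
so averaging it over `I` produces derivatives of the Laplace transform of `I`. Polar coordinates and
`r ^ 2 = ρ ^ 2 + h ^ 2` give the radial integral.

The process is specified only through its counts, so Slivnyak–Mecke is derived from the probability
generating functional. For a simple function the functional is a product of generating functions of
independent Poisson counts on level sets; dominated convergence extends it to bounded measurable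
functions and Fubini to independent marks. Applying it to `q + e * v` and differentiating at `e = 0`
yields the multiplicative Campbell–Mecke formula. With `q = exp (i t w)` and `v` an indicator, this
computes the characteristic function of every slice of the reduced Campbell measure, which is
therefore a product. The same functional at `exp (-s w)` gives `laplaceI`. -/

/-! ### Generating function of the Poisson law; Laplace transform and tail of the gamma law. -/

theorem hasSum_pow_poisson (r : NNReal) (z : ℂ) :
    HasSum (fun n : ℕ => (Real.exp (-r) * r ^ n / n.factorial) • z ^ n)
      (Complex.exp (r * (z - 1))) := by
  have h := (NormedSpace.expSeries_div_hasSum_exp ((r : ℂ) * z)).mul_left (Complex.exp (-r))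
  rw [← Complex.exp_eq_exp_ℂ, ← Complex.exp_add] at h
  rw [show (r : ℂ) * (z - 1) = -(r : ℂ) + r * z by ring]
  refine h.congr_fun fun n => ?_
  rw [Complex.real_smul]
  push_cast
  rw [mul_pow]
  ring

/-- The generating function is entire. Values outside the unit disk are needed: powers `K ^ N` and
`4 ^ N` of a count serve below as dominating functions. -/
theorem integrable_pow_poissonMeasure (r : NNReal) (z : ℂ) :
    Integrable (fun n : ℕ => z ^ n) (poissonMeasure r) := by
  rw [integrable_poissonMeasure_iff]
  have h := (hasSum_pow_poisson r (‖z‖ : ℂ)).summable.norm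
  refine h.congr fun n => ?_
  rw [norm_smul, norm_pow, norm_pow, Complex.norm_real, norm_norm, Real.norm_of_nonneg]
  positivity

theorem integral_pow_poissonMeasure (r : NNReal) (z : ℂ) :
    ∫ n, z ^ n ∂(poissonMeasure r) = Complex.exp (r * (z - 1)) := by
  rw [integral_poissonMeasure]
  exact (hasSum_pow_poisson r z).tsum_eq

theorem gammaMeasure_eq_withDensity_restrict (a r : ℝ) :
    gammaMeasure a r = (volume.restrict (Set.Ici 0)).withDensity
      (fun x => ENNReal.ofReal (r ^ a / Real.Gamma a * x ^ (a - 1) * Real.exp (-(r * x)))) := by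
  rw [gammaMeasure, ← withDensity_indicator measurableSet_Ici]
  congr 1
  ext x
  by_cases hx : 0 ≤ x
  · rw [gammaPDF_of_nonneg hx, Set.indicator_of_mem (by exact hx)]
  · rw [gammaPDF_of_neg (not_le.1 hx), Set.indicator_of_notMem (by exact hx)]

theorem gammaMeasure_ae_nonneg (a r : ℝ) : ∀ᵐ x ∂(gammaMeasure a r), 0 ≤ x := by
  rw [gammaMeasure_eq_withDensity_restrict]
  exact (withDensity_absolutelyContinuous _ _).ae_le (ae_restrict_mem measurableSet_Ici)

theorem integral_exp_neg_mul_gammaMeasure {m : ℕ} (hm : 1 ≤ m) {s : ℝ} (hs : 0 ≤ s) :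
    ∫ g, Real.exp (-s * g) ∂(gammaMeasure m m) = (1 + s / m) ^ (-(m : ℤ)) := by
  have hm0 : (0 : ℝ) < m := by exact_mod_cast hm
  rw [gammaMeasure_eq_withDensity_restrict, integral_withDensity_eq_integral_toReal_smul
    (by fun_prop) (by simp), integral_Ici_eq_integral_Ioi]
  -- Tilting by `exp (-s g)` turns the rate `m` into `m + s`; the answer is the ratio of the
  -- normalizing constants.
  have key := Real.integral_rpow_mul_exp_neg_mul_Ioi (a := m) (r := m + s) hm0 (by positivity)
  have : ∫ x in Set.Ioi (0 : ℝ), (ENNReal.ofReal ((m : ℝ) ^ (m : ℝ) / Real.Gamma m *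
      x ^ ((m : ℝ) - 1) * Real.exp (-(m * x)))).toReal • Real.exp (-s * x) =
      ∫ x in Set.Ioi (0 : ℝ), ((m : ℝ) ^ (m : ℝ) / Real.Gamma m) *
        (x ^ ((m : ℝ) - 1) * Real.exp (-((m + s) * x))) := by
    refine setIntegral_congr_fun measurableSet_Ioi fun x hx => ?_
    have hx : 0 < x := hx
    have hG := Real.Gamma_pos_of_pos hm0
    simp only [smul_eq_mul]
    rw [ENNReal.toReal_ofReal (by positivity), mul_assoc, mul_assoc, ← Real.exp_add]
    congr 3
    ring
  rw [this, integral_const_mul, key]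
  have hG := (Real.Gamma_pos_of_pos hm0).ne'
  have h1 : 1 + s / m = (m + s) / m := by field_simp
  rw [h1, zpow_neg, zpow_natCast, Real.rpow_natCast, Real.rpow_natCast]
  have : (0:ℝ) < m + s := by positivity
  rw [div_mul_comm, mul_comm, mul_div_cancel_right₀ _ hG, one_div, div_pow, inv_div, inv_pow,
    div_eq_mul_inv]

/-- The derivatives of the successive terms telescope, leaving only the top one: an explicit
antiderivative of the gamma density of shape `m + 1`. -/
theorem hasDerivAt_exp_mul_sum_pow_div_factorial (m : ℕ) (x : ℝ) :
    HasDerivAt (fun x : ℝ => -(Real.exp (-x) * ∑ k ∈ Finset.range (m + 1), x ^ k / k.factorial))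
      (x ^ m / m.factorial * Real.exp (-x)) x := by
  induction m with
  | zero =>
    refine ((hasDerivAt_id x).neg.exp.neg.congr_of_eventuallyEq
      (.of_forall fun y => ?_)).congr_deriv ?_ <;> simp
  | succ m ih =>
    have h2 : HasDerivAt (fun x : ℝ => -(Real.exp (-x) * (x ^ (m + 1) / (m + 1).factorial)))
        (x ^ (m + 1) / (m + 1).factorial * Real.exp (-x) - x ^ m / m.factorial * Real.exp (-x))
        x := by
      have h := ((hasDerivAt_id x).neg.exp.mul
        ((hasDerivAt_pow (m + 1) x).div_const ((m + 1).factorial : ℝ))).neg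
      refine h.congr_deriv ?_
      have : ((m + 1).factorial : ℝ) = (m + 1) * m.factorial := by
        push_cast [Nat.factorial_succ]; ring
      have h0 : (m.factorial : ℝ) ≠ 0 := by positivity
      have h1 : (m + 1 : ℝ) ≠ 0 := by positivity
      simp only [this, id, Nat.add_sub_cancel, Pi.neg_apply]
      push_cast
      field_simp
      ring
    refine ((ih.add h2).congr_of_eventuallyEq (.of_forall fun y => ?_)).congr_deriv (by ring)
    simp only [Finset.sum_range_succ _ (m + 1), Pi.add_apply]
    ring

theorem gammaMeasure_real_Ici {m : ℕ} (hm : 1 ≤ m) {x : ℝ} (hx : 0 ≤ x) :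
    (gammaMeasure m m).real (Set.Ici x) =
      Real.exp (-(m * x)) * ∑ k ∈ Finset.range m, (m * x) ^ k / k.factorial := by
  -- The density of shape `n + 1` carries the power `n`, and `Γ (n + 1) = n!`.
  obtain ⟨n, rfl⟩ : ∃ n, m = n + 1 := ⟨m - 1, by omega⟩
  set M : ℝ := ((n + 1 : ℕ) : ℝ) with hM
  have hm0 : (0 : ℝ) < M := by positivity
  have hder : ∀ y : ℝ, HasDerivAt (fun y : ℝ => -(Real.exp (-(M * y)) *
      ∑ k ∈ Finset.range (n + 1), (M * y) ^ k / k.factorial))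
      ((M * y) ^ n / n.factorial * Real.exp (-(M * y)) * M) y := fun y =>
    (hasDerivAt_exp_mul_sum_pow_div_factorial n (M * y)).comp y
      (by simpa using (hasDerivAt_id y).const_mul M)
  have hpos : ∀ y ∈ Set.Ioi x, 0 ≤ (M * y) ^ n / n.factorial * Real.exp (-(M * y)) * M := by
    intro y hy
    have : 0 < y := hx.trans_lt hy
    positivity
  have hlim : Filter.Tendsto (fun y : ℝ => -(Real.exp (-(M * y)) *
      ∑ k ∈ Finset.range (n + 1), (M * y) ^ k / k.factorial)) Filter.atTop (nhds 0) := by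
    have h : Filter.Tendsto (fun y : ℝ => -∑ k ∈ Finset.range (n + 1),
        (y ^ k * Real.exp (-y)) / k.factorial) Filter.atTop
        (nhds (-∑ k ∈ Finset.range (n + 1), 0 / (k.factorial : ℝ))) :=
      (tendsto_finsetSum _ fun k _ =>
        (Real.tendsto_pow_mul_exp_neg_atTop_nhds_zero k).div_const _).neg
    simp only [zero_div, Finset.sum_const_zero, neg_zero] at h
    refine (h.comp (Filter.tendsto_id.const_mul_atTop hm0)).congr fun y => ?_
    simp only [Function.comp, id, Finset.mul_sum]
    congr 1
    exact Finset.sum_congr rfl fun k _ => by ring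
  have hint := integral_Ioi_of_hasDerivAt_of_nonneg' (a := x) (fun y _ => hder y) hpos hlim
  rw [zero_sub, neg_neg] at hint
  rw [← hint, measureReal_def, gammaMeasure_eq_withDensity_restrict, withDensity_apply _
    measurableSet_Ici, Measure.restrict_restrict measurableSet_Ici, Set.Ici_inter_Ici,
    sup_eq_left.2 hx, restrict_Ioi_eq_restrict_Ici.symm, ← integral_toReal (by fun_prop) (by simp)]
  refine setIntegral_congr_fun measurableSet_Ioi fun y hy => ?_
  have hy : 0 < y := hx.trans_lt hy
  have hG := Real.Gamma_pos_of_pos hm0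
  rw [ENNReal.toReal_ofReal (by positivity), hM, Nat.cast_succ, Real.Gamma_nat_eq_factorial,
    add_sub_cancel_right, Real.rpow_natCast, ← Nat.cast_succ, Real.rpow_natCast, pow_succ, mul_pow]
  ring

/-! ### Measurability of products and sums over a random number of indices. -/

theorem measurable_prod_range_comp {Ω M : Type*} [MeasurableSpace Ω] [MeasurableSpace M]
    [CommMonoid M] [MeasurableMul₂ M] {N : Ω → ℕ} (hN : Measurable N) {f : ℕ → Ω → M}
    (hf : ∀ n, Measurable (f n)) : Measurable (fun ω => ∏ n ∈ Finset.range (N ω), f n ω) := by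
  have : Measurable (fun p : ℕ × Ω => ∏ n ∈ Finset.range p.1, f n p.2) :=
    measurable_from_prod_countable_right fun k => by
      exact Finset.measurable_fun_prod (Finset.range k) fun n _ => hf n
  exact this.comp (hN.prodMk measurable_id)

theorem measurable_sum_range_comp {Ω M : Type*} [MeasurableSpace Ω] [MeasurableSpace M]
    [AddCommMonoid M] [MeasurableAdd₂ M] {N : Ω → ℕ} (hN : Measurable N) {f : ℕ → Ω → M}
    (hf : ∀ n, Measurable (f n)) : Measurable (fun ω => ∑ n ∈ Finset.range (N ω), f n ω) := by
  have : Measurable (fun p : ℕ × Ω => ∑ n ∈ Finset.range p.1, f n p.2) :=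
    measurable_from_prod_countable_right fun k => by
      exact Finset.measurable_fun_sum (Finset.range k) fun n _ => hf n
  exact this.comp (hN.prodMk measurable_id)

/-! ### The probability generating functional of node positions. -/

namespace NodeField

variable {Ω : Type*}

open Classical in
/-- The indices of the nodes located in `S`. -/
noncomputable def nodes (F : NodeField Ω) (S : Set Plane) (ω : Ω) : Finset ℕ :=
  (Finset.range (F.card ω)).filter (fun n => F.pos n ω ∈ S)

theorem card_nodes (F : NodeField Ω) (S : Set Plane) (ω : Ω) :
    (F.nodes S ω).card = F.count S ω := rfl

theorem mem_nodes {F : NodeField Ω} {S : Set Plane} {ω : Ω} {n : ℕ} :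
    n ∈ F.nodes S ω ↔ n < F.card ω ∧ F.pos n ω ∈ S := by
  simp [nodes]

variable {F : NodeField Ω} {S : Set Plane}

/-- Grouping the nodes by the value of `u` leaves a finite product in which the process enters only
through counts, the sole data that the Poisson hypothesis controls. -/
theorem prod_nodes_simpleFunc (u : SimpleFunc Plane ℂ) (ω : Ω) :
    ∏ n ∈ F.nodes S ω, u (F.pos n ω) = ∏ z ∈ u.range, z ^ F.count (S ∩ u ⁻¹' {z}) ω := by
  classical
  rw [← Finset.prod_fiberwise_of_maps_to (s := F.nodes S ω) (t := u.range)
    (g := fun n => u (F.pos n ω)) (fun n _ => u.mem_range_self _)]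
  refine Finset.prod_congr rfl fun z _ => ?_
  rw [Finset.prod_congr rfl (g := fun _ => z) (fun n hn => (Finset.mem_filter.1 hn).2),
    Finset.prod_const]
  congr 1
  rw [count]
  congr 1
  ext n
  simp [mem_nodes, and_assoc]

variable [MeasurableSpace Ω] {μ : Measure Ω} {A : Set Plane} {lam : ℝ}

open Classical in
theorem measurable_prod_nodes {M : Type*} [MeasurableSpace M] [CommMonoid M] [MeasurableMul₂ M]
    (hcard : Measurable F.card) (hpos : ∀ n, Measurable (F.pos n)) (hS : MeasurableSet S)
    {f : ℕ → Ω → M} (hf : ∀ n, Measurable (f n)) :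
    Measurable (fun ω => ∏ n ∈ F.nodes S ω, f n ω) := by
  simp only [nodes, Finset.prod_filter]
  exact measurable_prod_range_comp hcard fun n => (hf n).ite (hpos n hS) measurable_const

open Classical in
theorem measurable_sum_nodes {M : Type*} [MeasurableSpace M] [AddCommMonoid M] [MeasurableAdd₂ M]
    (hcard : Measurable F.card) (hpos : ∀ n, Measurable (F.pos n)) (hS : MeasurableSet S)
    {f : ℕ → Ω → M} (hf : ∀ n, Measurable (f n)) :
    Measurable (fun ω => ∑ n ∈ F.nodes S ω, f n ω) := by
  simp only [nodes, Finset.sum_filter]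
  exact measurable_sum_range_comp hcard fun n => (hf n).ite (hpos n hS) measurable_const

theorem IsHomogeneousPPP.integrable_pow_count (h : F.IsHomogeneousPPP μ A lam) (hSA : S ⊆ A)
    (hS : MeasurableSet S) (z : ℂ) : Integrable (fun ω => z ^ F.count S ω) μ := by
  have hl := h.poisson_count S hSA hS
  have := integrable_pow_poissonMeasure (lam * volume.real S).toNNReal z
  rw [← hl.map_eq] at this
  exact this.comp_aemeasurable hl.aemeasurable

theorem IsHomogeneousPPP.integral_pow_count (h : F.IsHomogeneousPPP μ A lam) (hlam : 0 ≤ lam)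
    (hSA : S ⊆ A) (hS : MeasurableSet S) (z : ℂ) :
    ∫ ω, z ^ F.count S ω ∂μ = Complex.exp (lam * volume.real S * (z - 1)) := by
  have hl := h.poisson_count S hSA hS
  have := integral_pow_poissonMeasure (lam * volume.real S).toNNReal z
  rw [← hl.map_eq, integral_map hl.aemeasurable (by fun_prop)] at this
  rw [this]
  have : 0 ≤ lam * volume.real S := by positivity
  congr 2
  rw [← Complex.ofReal_mul]
  exact_mod_cast Real.coe_toNNReal _ this

theorem IsHomogeneousPPP.integral_prod_nodes_simpleFunc (h : F.IsHomogeneousPPP μ A lam)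
    (hlam : 0 ≤ lam) (hSA : S ⊆ A) (hS : MeasurableSet S) (hSfin : volume S ≠ ⊤)
    (u : SimpleFunc Plane ℂ) :
    ∫ ω, ∏ n ∈ F.nodes S ω, u (F.pos n ω) ∂μ =
      Complex.exp (lam * ∫ x in S, (u x - 1)) := by
  have : IsFiniteMeasure (volume.restrict S) := isFiniteMeasure_restrict.2 hSfin
  simp only [prod_nodes_simpleFunc]
  have hmeas : ∀ z, MeasurableSet (S ∩ u ⁻¹' {z}) := fun z => hS.inter (u.measurableSet_fiber z)
  have hsub : ∀ z, S ∩ u ⁻¹' {z} ⊆ A := fun z => Set.inter_subset_left.trans hSA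
  let e := u.range.equivFin
  -- The level sets are disjoint, so their counts are independent; the enumeration `e` matches the
  -- `Fin k` indexing of the hypothesis.
  have hind : iIndepFun (fun z : u.range => F.count (S ∩ u ⁻¹' {(z : ℂ)})) μ := by
    refine iIndepFun.of_precomp (g := e.symm) e.symm.surjective ?_
    refine h.indep_count _ (fun j => S ∩ u ⁻¹' {((e.symm j : u.range) : ℂ)})
      (fun j => hsub _) (fun j => hmeas _) fun i j hij => ?_
    refine Set.disjoint_left.2 fun x hx hy => hij ?_
    have : ((e.symm i : u.range) : ℂ) = e.symm j := hx.2.symm.trans hy.2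
    exact e.symm.injective (Subtype.ext this)
  have h1 : ∀ ω, ∏ z ∈ u.range, z ^ F.count (S ∩ u ⁻¹' {z}) ω =
      ∏ z : u.range, (z : ℂ) ^ F.count (S ∩ u ⁻¹' {(z : ℂ)}) ω := fun ω =>
    (Finset.prod_coe_sort u.range (fun z => z ^ F.count (S ∩ u ⁻¹' {z}) ω)).symm
  simp only [h1]
  rw [hind.integral_fun_prod_comp (f := fun (z : u.range) (n : ℕ) => (z : ℂ) ^ n)
    (fun z => (h.poisson_count _ (hsub z) (hmeas z)).aemeasurable)
    (fun z => (measurable_of_countable _).aestronglyMeasurable)]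
  simp only [h.integral_pow_count hlam (hsub _) (hmeas _)]
  rw [← Complex.exp_sum]
  congr 1
  have hu : Integrable u (volume.restrict S) := SimpleFunc.integrable_of_isFiniteMeasure u
  rw [Finset.sum_coe_sort u.range
    (fun z => (lam : ℂ) * volume.real (S ∩ u ⁻¹' {z}) * (z - 1))]
  -- The level sets partition `S`, so the constant `1` integrates to the sum of their volumes and
  -- the Poisson exponents add up to one integral.
  have hmap : ∫ x in S, (u x - 1) = ∑ z ∈ u.range, (volume.real (S ∩ u ⁻¹' {z}) : ℂ) * (z - 1) := by
    have h1 : ∑ z ∈ u.range, volume.real (S ∩ u ⁻¹' {z}) = volume.real S := by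
      simp only [measureReal_def]
      rw [← ENNReal.toReal_sum fun z _ => measure_ne_top_of_subset Set.inter_subset_left hSfin,
        ← Measure.restrict_apply_univ S,
        ← u.sum_range_measure_preimage_singleton (volume.restrict S)]
      simp only [Measure.restrict_apply (u.measurableSet_fiber _), Set.inter_comm S]
    rw [integral_sub hu (integrable_const _), SimpleFunc.integral_eq_sum u hu, integral_const,
      measureReal_restrict_apply_univ, ← h1, Finset.sum_smul, ← Finset.sum_sub_distrib]
    refine Finset.sum_congr rfl fun z _ => ?_
    rw [measureReal_restrict_apply (u.measurableSet_fiber _), Set.inter_comm, mul_sub,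
      Complex.real_smul, Complex.real_smul]
  rw [hmap, Finset.mul_sum]
  exact Finset.sum_congr rfl fun z _ => by ring

theorem IsHomogeneousPPP.integrable_prod_nodes (h : F.IsHomogeneousPPP μ A lam)
    (hSA : S ⊆ A) (hS : MeasurableSet S) {f : ℕ → Ω → ℂ} (hf : ∀ n, Measurable (f n))
    {K : ℝ} (hK : 0 ≤ K) (hb : ∀ n ω, ‖f n ω‖ ≤ K) :
    Integrable (fun ω => ∏ n ∈ F.nodes S ω, f n ω) μ := by
  refine (h.integrable_pow_count hSA hS K).mono
    (measurable_prod_nodes h.measurable_card h.measurable_pos hS hf).aestronglyMeasurable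
    (.of_forall fun ω => ?_)
  rw [norm_prod, norm_pow, Complex.norm_real, Real.norm_of_nonneg hK, ← card_nodes,
    ← Finset.prod_const]
  exact Finset.prod_le_prod (fun _ _ => norm_nonneg _) fun n _ => hb n ω

/-- The probability generating functional of a Poisson process. -/
theorem IsHomogeneousPPP.integral_prod_nodes_pos (h : F.IsHomogeneousPPP μ A lam)
    (hlam : 0 ≤ lam) (hSA : S ⊆ A) (hS : MeasurableSet S) (hSfin : volume S ≠ ⊤)
    {u : Plane → ℂ} (hu : Measurable u) {K : ℝ} (hb : ∀ x, ‖u x‖ ≤ K) :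
    ∫ ω, ∏ n ∈ F.nodes S ω, u (F.pos n ω) ∂μ =
      Complex.exp (lam * ∫ x in S, (u x - 1)) := by
  have : IsFiniteMeasure (volume.restrict S) := isFiniteMeasure_restrict.2 hSfin
  have hK : 0 ≤ K := (norm_nonneg _).trans (hb 0)
  have hus := hu.stronglyMeasurable
  -- The approximants keep the bound `K`, so one function `K ^ N`, with `N` the count in `S`,
  -- dominates all the products.
  let v : ℕ → SimpleFunc Plane ℂ := hus.approxBounded K
  have hvb : ∀ k x, ‖v k x‖ ≤ K := fun k x => hus.norm_approxBounded_le hK k x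
  have hvt : ∀ x, Filter.Tendsto (fun k => v k x) Filter.atTop (nhds (u x)) := fun x =>
    hus.tendsto_approxBounded_of_norm_le (hb x)
  have hl : Filter.Tendsto (fun k => ∫ ω, ∏ n ∈ F.nodes S ω, v k (F.pos n ω) ∂μ) Filter.atTop
      (nhds (∫ ω, ∏ n ∈ F.nodes S ω, u (F.pos n ω) ∂μ)) := by
    refine tendsto_integral_of_dominated_convergence (fun ω => ‖(K : ℂ) ^ F.count S ω‖)
      (fun k => (measurable_prod_nodes h.measurable_card h.measurable_pos hS fun n =>
        (v k).measurable.comp (h.measurable_pos n)).aestronglyMeasurable)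
      (h.integrable_pow_count hSA hS K).norm (fun k => .of_forall fun ω => ?_)
      (.of_forall fun ω => tendsto_finsetProd _ fun n _ => hvt _)
    rw [norm_prod, norm_pow, Complex.norm_real, Real.norm_of_nonneg hK, ← card_nodes,
      ← Finset.prod_const]
    exact Finset.prod_le_prod (fun _ _ => norm_nonneg _) fun n _ => hvb k _
  have hr : Filter.Tendsto (fun k => ∫ x in S, (v k x - 1)) Filter.atTop
      (nhds (∫ x in S, (u x - 1))) := by
    refine tendsto_integral_of_dominated_convergence (fun _ => K + 1)
      (fun k => ((v k).measurable.sub_const 1).aestronglyMeasurable) (integrable_const _)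
      (fun k => .of_forall fun x => ?_) (.of_forall fun x => (hvt x).sub_const 1)
    exact (norm_sub_le _ _).trans (by simpa using hvb k x)
  refine tendsto_nhds_unique hl ?_
  simp only [h.integral_prod_nodes_simpleFunc hlam hSA hS hSfin]
  exact (Complex.continuous_exp.tendsto _).comp (hr.const_mul _)

end NodeField

/-! ### Independent marks: generating functional and multiplicative Campbell–Mecke formula. -/

namespace NodeField

variable {Ω T : Type*} [MeasurableSpace Ω] [MeasurableSpace T]
  {F : NodeField Ω} {μ : Measure Ω} {A S : Set Plane} {lam : ℝ}

/-- The marks are i.i.d. with law `κ` and independent of the node positions. -/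
structure IsIndepMarking (F : NodeField Ω) (μ : Measure Ω) (mark : ℕ → Ω → T) (κ : Measure T) :
    Prop where
  measurable_mark : ∀ n, Measurable (mark n)
  map_mark : ∀ n, μ.map (mark n) = κ
  iIndep : iIndepFun mark μ
  indep_pos : IndepFun (fun ω => (F.card ω, fun n => F.pos n ω)) (fun ω n => mark n ω) μ

open Classical in
theorem measurable_prod_nodes_erase {M : Type*} [MeasurableSpace M] [CommMonoid M]
    [MeasurableMul₂ M] (hcard : Measurable F.card) (hpos : ∀ n, Measurable (F.pos n))
    (hS : MeasurableSet S) {f : ℕ → Ω → M} (hf : ∀ n, Measurable (f n)) (k : ℕ) :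
    Measurable (fun ω => ∏ n ∈ (F.nodes S ω).erase k, f n ω) := by
  have he : ∀ s : Finset ℕ, s.erase k = s.filter (fun n => n ≠ k) := fun s => by
    ext n; simp [and_comm]
  simp only [he, Finset.prod_filter]
  refine measurable_prod_nodes hcard hpos hS fun n => ?_
  by_cases h : n = k
  · simp [h]
  · simpa [h] using hf n

variable {mark : ℕ → Ω → T} {κ : Measure T}

open Classical in
/-- The probability generating functional of an independently marked Poisson process. -/
theorem IsHomogeneousPPP.integral_prod_nodes [IsProbabilityMeasure μ]
    (h : F.IsHomogeneousPPP μ A lam) (hM : F.IsIndepMarking μ mark κ)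
    (hlam : 0 ≤ lam) (hSA : S ⊆ A) (hS : MeasurableSet S) (hSfin : volume S ≠ ⊤)
    {u : Plane × T → ℂ} (hu : Measurable u) {K : ℝ} (hb : ∀ x, ‖u x‖ ≤ K) :
    ∫ ω, ∏ n ∈ F.nodes S ω, u (F.pos n ω, mark n ω) ∂μ =
      Complex.exp (lam * ∫ x in S, (∫ t, u (x, t) ∂κ - 1)) := by
  have hκ : IsProbabilityMeasure κ := by
    rw [← hM.map_mark 0]
    exact Measure.isProbabilityMeasure_map (hM.measurable_mark 0).aemeasurable
  have hK : 0 ≤ K := (norm_nonneg _).trans (hb (0, κ.nonempty_of_neZero.some))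
  let X : Ω → ℕ × (ℕ → Plane) := fun ω => (F.card ω, fun n => F.pos n ω)
  let Y : Ω → ℕ → T := fun ω n => mark n ω
  have hX : Measurable X := h.measurable_card.prodMk (measurable_pi_iff.2 h.measurable_pos)
  have hY : Measurable Y := measurable_pi_iff.2 hM.measurable_mark
  -- The product becomes a deterministic functional of the positions `X` and the marks `Y`, so that
  -- their independence allows Fubini.
  let G : (ℕ × (ℕ → Plane)) × (ℕ → T) → ℂ := fun p =>
    ∏ n ∈ Finset.range p.1.1, if p.1.2 n ∈ S then u (p.1.2 n, p.2 n) else 1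
  have hG : Measurable G := by
    refine measurable_prod_range_comp (by fun_prop) fun n => ?_
    exact Measurable.ite ((by fun_prop : Measurable fun p : (ℕ × (ℕ → Plane)) × (ℕ → T) =>
      p.1.2 n) hS) (by fun_prop) measurable_const
  have hGXY : ∀ ω, ∏ n ∈ F.nodes S ω, u (F.pos n ω, mark n ω) = G (X ω, Y ω) := fun ω => by
    simp only [nodes, Finset.prod_filter, G, X, Y]
  have hint : Integrable G ((μ.map X).prod (μ.map Y)) := by
    rw [← (indepFun_iff_map_prod_eq_prod_map_map hX.aemeasurable hY.aemeasurable).1 hM.indep_pos,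
      integrable_map_measure hG.aestronglyMeasurable (hX.prodMk hY).aemeasurable]
    refine (h.integrable_prod_nodes hSA hS (fun n => hu.comp ((h.measurable_pos n).prodMk
      (hM.measurable_mark n))) hK fun n ω => hb _).congr (.of_forall fun ω => ?_)
    exact hGXY ω
  -- With the positions frozen, independence of the marks factors the mean: what remains is a
  -- product over positions with `u` replaced by its average over `κ`.
  have hinner : ∀ x : ℕ × (ℕ → Plane), ∫ y, G (x, y) ∂(μ.map Y) =
      ∏ n ∈ Finset.range x.1, if x.2 n ∈ S then ∫ t, u (x.2 n, t) ∂κ else 1 := fun x => by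
    have hf : ∀ n, Measurable (fun t => if x.2 n ∈ S then u (x.2 n, t) else 1) := fun n => by
      split_ifs
      · fun_prop
      · fun_prop
    rw [integral_map (f := fun y => G (x, y)) hY.aemeasurable
      (hG.comp measurable_prodMk_left).aestronglyMeasurable]
    have h1 : ∀ ω, G (x, Y ω) = ∏ n : Finset.range x.1,
        (fun (n : Finset.range x.1) t => if x.2 n ∈ S then u (x.2 n, t) else 1) n (mark n ω) :=
      fun ω => (Finset.prod_coe_sort (Finset.range x.1)
        (fun n => if x.2 n ∈ S then u (x.2 n, mark n ω) else 1)).symm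
    simp only [h1]
    rw [(hM.iIndep.precomp Subtype.val_injective).integral_fun_prod_comp
      (f := fun (n : Finset.range x.1) t => if x.2 n ∈ S then u (x.2 n, t) else 1)
      (fun n => (hM.measurable_mark n).aemeasurable) (fun n => (hf n).aestronglyMeasurable),
      ← Finset.prod_coe_sort (Finset.range x.1)
        (fun n => if x.2 n ∈ S then ∫ t, u (x.2 n, t) ∂κ else 1)]
    refine Finset.prod_congr rfl fun n _ => ?_
    rw [← integral_map (f := fun t => if x.2 n ∈ S then u (x.2 n, t) else 1)
      (hM.measurable_mark n).aemeasurable (hf n).aestronglyMeasurable, hM.map_mark]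
    split_ifs <;> simp
  have hmean : Measurable (fun x => ∫ t, u (x, t) ∂κ) :=
    (hu.stronglyMeasurable.integral_prod_right' (ν := κ)).measurable
  simp only [hGXY]
  rw [← integral_map (f := G) (hX.prodMk hY).aemeasurable hG.aestronglyMeasurable,
    (indepFun_iff_map_prod_eq_prod_map_map hX.aemeasurable hY.aemeasurable).1 hM.indep_pos,
    integral_prod _ hint, ← h.integral_prod_nodes_pos hlam hSA hS hSfin hmean
      (K := K) (fun x => by
        simpa using norm_integral_le_of_norm_le_const (μ := κ) (.of_forall fun t => hb (x, t)))]
  rw [integral_map hX.aemeasurable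
    (hG.stronglyMeasurable.integral_prod_right').aestronglyMeasurable]
  refine integral_congr_ae (.of_forall fun ω => ?_)
  simp only [hinner, nodes, Finset.prod_filter, X]

/-- The reduced Campbell–Mecke formula of an independently marked Poisson process, for multiplicative
functionals. -/
theorem IsHomogeneousPPP.integral_sum_mul_prod_nodes_erase [IsProbabilityMeasure μ]
    (h : F.IsHomogeneousPPP μ A lam) (hM : F.IsIndepMarking μ mark κ)
    (hlam : 0 ≤ lam) (hSA : S ⊆ A) (hS : MeasurableSet S) (hSfin : volume S ≠ ⊤)
    {q v : Plane × T → ℂ} (hq : Measurable q) (hqb : ∀ x, ‖q x‖ ≤ 1)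
    (hv : Measurable v) (hvb : ∀ x, ‖v x‖ ≤ 1) :
    ∫ ω, ∑ n ∈ F.nodes S ω, (∏ j ∈ (F.nodes S ω).erase n, q (F.pos j ω, mark j ω)) *
        v (F.pos n ω, mark n ω) ∂μ =
      lam * (∫ x in S, ∫ t, v (x, t) ∂κ) *
        Complex.exp (lam * ∫ x in S, (∫ t, q (x, t) ∂κ - 1)) := by
  have hκ : IsProbabilityMeasure κ := by
    rw [← hM.map_mark 0]
    exact Measure.isProbabilityMeasure_map (hM.measurable_mark 0).aemeasurable
  have : IsFiniteMeasure (volume.restrict S) := isFiniteMeasure_restrict.2 hSfin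
  have hpt : ∀ n, Measurable fun ω => (F.pos n ω, mark n ω) := fun n =>
    (h.measurable_pos n).prodMk (hM.measurable_mark n)
  have hw : ∀ (e : ℂ) (n : ℕ), Measurable fun ω =>
      q (F.pos n ω, mark n ω) + e * v (F.pos n ω, mark n ω) := fun e n =>
    (hq.comp (hpt n)).add ((hv.comp (hpt n)).const_mul e)
  have hwb : ∀ e ∈ Metric.ball (0 : ℂ) 1, ∀ x, ‖q x + e * v x‖ ≤ 2 := fun e he x => by
    have he : ‖e‖ ≤ 1 := (mem_ball_zero_iff.1 he).le
    calc ‖q x + e * v x‖ ≤ ‖q x‖ + ‖e‖ * ‖v x‖ := (norm_add_le _ _).trans_eq (by rw [norm_mul])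
      _ ≤ 1 + 1 * 1 := by gcongr <;> simp [hqb, hvb]
      _ = 2 := by norm_num
  -- Differentiation of the generating functional at `e = 0` under the expectation. For `‖e‖ < 1`
  -- each factor has norm at most `2`, so the derivative, a sum of `N` terms, is bounded by `N * 2 ^
  -- N ≤ 4 ^ N`.
  have hL := hasDerivAt_integral_of_dominated_loc_of_deriv_le (μ := μ) (x₀ := (0 : ℂ))
    (F := fun e ω => ∏ n ∈ F.nodes S ω, (q (F.pos n ω, mark n ω) + e * v (F.pos n ω, mark n ω)))
    (F' := fun e ω => ∑ n ∈ F.nodes S ω, (∏ j ∈ (F.nodes S ω).erase n,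
      (q (F.pos j ω, mark j ω) + e * v (F.pos j ω, mark j ω))) * v (F.pos n ω, mark n ω))
    (bound := fun ω => ‖(4 : ℂ) ^ F.count S ω‖) (Metric.ball_mem_nhds (0 : ℂ) one_pos)
    (.of_forall fun e => (measurable_prod_nodes h.measurable_card h.measurable_pos hS
      (hw e)).aestronglyMeasurable)
    (h.integrable_prod_nodes hSA hS (hw 0) two_pos.le fun n ω => hwb 0 (by simp) _)
    (measurable_sum_nodes h.measurable_card h.measurable_pos hS fun n =>
      (measurable_prod_nodes_erase h.measurable_card h.measurable_pos hS (hw 0) n).mul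
        (hv.comp (hpt n))).aestronglyMeasurable
    (.of_forall fun ω e he => by
      refine (norm_sum_le _ _).trans ?_
      have hterm : ∀ n ∈ F.nodes S ω, ‖(∏ j ∈ (F.nodes S ω).erase n,
          (q (F.pos j ω, mark j ω) + e * v (F.pos j ω, mark j ω))) * v (F.pos n ω, mark n ω)‖ ≤
          2 ^ F.count S ω := fun n hn => by
        rw [norm_mul, norm_prod]
        calc _ ≤ (∏ j ∈ (F.nodes S ω).erase n, (2 : ℝ)) * 1 :=
              mul_le_mul (Finset.prod_le_prod (fun _ _ => norm_nonneg _) fun j _ => hwb e he _)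
                (hvb _) (norm_nonneg _) (by positivity)
          _ ≤ 2 ^ F.count S ω := by
              rw [mul_one, Finset.prod_const, ← card_nodes]
              exact pow_le_pow_right₀ one_le_two (Finset.card_le_card (Finset.erase_subset _ _))
      refine (Finset.sum_le_card_nsmul _ _ _ hterm).trans ?_
      rw [card_nodes, nsmul_eq_mul, norm_pow]
      have h2 : ((F.count S ω : ℕ) : ℝ) ≤ 2 ^ F.count S ω := by
        exact_mod_cast Nat.lt_two_pow_self.le
      have h4 : ‖(4 : ℂ)‖ = 2 * 2 := by norm_num
      rw [h4, mul_pow]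
      gcongr)
    (h.integrable_pow_count hSA hS 4).norm
    (.of_forall fun ω e he => by
      have := HasDerivAt.fun_finsetProd (u := F.nodes S ω) (x := e)
        (f := fun n e => q (F.pos n ω, mark n ω) + e * v (F.pos n ω, mark n ω))
        (f' := fun n => v (F.pos n ω, mark n ω))
        (fun n _ => ((hasDerivAt_mul_const _).const_add _))
      simpa only [smul_eq_mul] using this)
  have hmv : Measurable (fun x => ∫ t, v (x, t) ∂κ) :=
    (hv.stronglyMeasurable.integral_prod_right' (ν := κ)).measurable
  have hmq : Measurable (fun x => ∫ t, q (x, t) ∂κ) :=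
    (hq.stronglyMeasurable.integral_prod_right' (ν := κ)).measurable
  have hvi : ∀ x, Integrable (fun t => v (x, t)) κ := fun x =>
    .of_bound (hv.comp measurable_prodMk_left).aestronglyMeasurable 1 (.of_forall fun t => hvb _)
  have hqi : ∀ x, Integrable (fun t => q (x, t)) κ := fun x =>
    .of_bound (hq.comp measurable_prodMk_left).aestronglyMeasurable 1 (.of_forall fun t => hqb _)
  have hIv : Integrable (fun x => ∫ t, v (x, t) ∂κ) (volume.restrict S) :=
    .of_bound hmv.aestronglyMeasurable 1 (.of_forall fun x => by
      simpa using norm_integral_le_of_norm_le_const (μ := κ) (.of_forall fun t => hvb (x, t)))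
  have hIq : Integrable (fun x => ∫ t, q (x, t) ∂κ - 1) (volume.restrict S) :=
    Integrable.sub (.of_bound hmq.aestronglyMeasurable 1 (.of_forall fun x => by
      simpa using norm_integral_le_of_norm_le_const (μ := κ) (.of_forall fun t => hqb (x, t))))
      (integrable_const _)
  -- The exponent in the closed form is affine in `e`. Both derivatives agree because the two
  -- functions coincide on the unit ball.
  have hR : HasDerivAt (fun e : ℂ => Complex.exp (lam * ((∫ x in S, (∫ t, q (x, t) ∂κ - 1)) +
      e * ∫ x in S, ∫ t, v (x, t) ∂κ))) (Complex.exp (lam * ((∫ x in S, (∫ t, q (x, t) ∂κ - 1)) +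
      0 * ∫ x in S, ∫ t, v (x, t) ∂κ)) * (lam * ∫ x in S, ∫ t, v (x, t) ∂κ)) 0 :=
    (((hasDerivAt_mul_const _).const_add _).const_mul _).cexp
  have hLR := hL.2.unique (hR.congr_of_eventuallyEq ?_)
  · simp only [zero_mul, add_zero] at hLR
    rw [hLR]
    ring
  · filter_upwards [Metric.ball_mem_nhds (0 : ℂ) one_pos] with e he
    rw [h.integral_prod_nodes hM hlam hSA hS hSfin (u := fun x => q x + e * v x)
      (hq.add (hv.const_mul e)) (K := 2) (hwb e he), ← integral_const_mul e,
      ← integral_add hIq (hIv.const_mul e)]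
    congr 2
    refine integral_congr_ae (.of_forall fun x => ?_)
    simp only
    rw [integral_add (hqi x) ((hvi x).const_mul e), integral_const_mul]
    ring

end NodeField

/-! ### The reduced Campbell measure of shot noise and its product form. -/

namespace NodeField

variable {Ω T : Type*} [MeasurableSpace Ω] [MeasurableSpace T]
  {F : NodeField Ω} {μ : Measure Ω} {A S : Set Plane} {lam : ℝ}
  {mark : ℕ → Ω → T} {κ : Measure T} {w : Plane × T → ℝ}

/-- The sum of the weights of all nodes of `S`. -/
noncomputable def shotNoise (F : NodeField Ω) (S : Set Plane) (mark : ℕ → Ω → T)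
    (w : Plane × T → ℝ) (ω : Ω) : ℝ :=
  ∑ n ∈ F.nodes S ω, w (F.pos n ω, mark n ω)

/-- The sum of the weights of the nodes of `S` other than `n`. -/
noncomputable def reducedShotNoise (F : NodeField Ω) (S : Set Plane) (mark : ℕ → Ω → T)
    (w : Plane × T → ℝ) (n : ℕ) (ω : Ω) : ℝ :=
  ∑ j ∈ (F.nodes S ω).erase n, w (F.pos j ω, mark j ω)

/-- The point, its mark and the weight of the remaining nodes. -/
noncomputable def palmPoint (F : NodeField Ω) (S : Set Plane) (mark : ℕ → Ω → T)
    (w : Plane × T → ℝ) (p : Ω × ℕ) : (Plane × T) × ℝ :=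
  ((F.pos p.2 p.1, mark p.2 p.1), F.reducedShotNoise S mark w p.2 p.1)

/-- The reduced Campbell measure of the shot noise. -/
noncomputable def campbell (F : NodeField Ω) (μ : Measure Ω) (S : Set Plane) (mark : ℕ → Ω → T)
    (w : Plane × T → ℝ) : Measure ((Plane × T) × ℝ) :=
  ((μ.prod Measure.count).restrict {p | p.2 ∈ F.nodes S p.1}).map (F.palmPoint S mark w)

theorem measurable_shotNoise (hcard : Measurable F.card) (hpos : ∀ n, Measurable (F.pos n))
    (hS : MeasurableSet S) (hmark : ∀ n, Measurable (mark n)) (hw : Measurable w) :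
    Measurable (F.shotNoise S mark w) :=
  measurable_sum_nodes hcard hpos hS fun n => hw.comp ((hpos n).prodMk (hmark n))

theorem measurable_reducedShotNoise (hcard : Measurable F.card)
    (hpos : ∀ n, Measurable (F.pos n)) (hS : MeasurableSet S) (hmark : ∀ n, Measurable (mark n))
    (hw : Measurable w) (n : ℕ) : Measurable (F.reducedShotNoise S mark w n) := by
  classical
  have he : ∀ s : Finset ℕ, s.erase n = s.filter (fun j => j ≠ n) := fun s => by
    ext j; simp [and_comm]
  unfold reducedShotNoise
  simp only [he, Finset.sum_filter]
  refine measurable_sum_nodes hcard hpos hS fun j => ?_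
  by_cases h : j = n
  · simp [h]
  · simp only [ne_eq, h, not_false_eq_true, if_true]
    exact hw.comp ((hpos j).prodMk (hmark j))

theorem measurable_palmPoint (hcard : Measurable F.card) (hpos : ∀ n, Measurable (F.pos n))
    (hS : MeasurableSet S) (hmark : ∀ n, Measurable (mark n)) (hw : Measurable w) :
    Measurable (F.palmPoint S mark w) :=
  measurable_from_prod_countable_left fun n =>
    ((hpos n).prodMk (hmark n)).prodMk (measurable_reducedShotNoise hcard hpos hS hmark hw n)

theorem measurableSet_mem_nodes (hcard : Measurable F.card) (hpos : ∀ n, Measurable (F.pos n))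
    (hS : MeasurableSet S) : MeasurableSet {p : Ω × ℕ | p.2 ∈ F.nodes S p.1} := by
  refine measurableSet_setOfPred.2 (measurable_from_prod_countable_left fun n => ?_)
  refine measurableSet_setOfPred.1 ?_
  simp only [mem_nodes]
  exact (measurableSet_lt measurable_const hcard).inter (hpos n hS)

/-- Tonelli for `μ` times counting measure: the restriction to pairs whose index is a node makes the
inner integral a finite sum. -/
theorem lintegral_campbell [SFinite μ] (hcard : Measurable F.card)
    (hpos : ∀ n, Measurable (F.pos n))
    (hS : MeasurableSet S) (hmark : ∀ n, Measurable (mark n)) (hw : Measurable w)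
    {f : (Plane × T) × ℝ → ENNReal} (hf : Measurable f) :
    ∫⁻ p, f p ∂(F.campbell μ S mark w) =
      ∫⁻ ω, ∑ n ∈ F.nodes S ω, f (F.palmPoint S mark w (ω, n)) ∂μ := by
  have hP := measurable_palmPoint hcard hpos hS hmark hw
  have hN := measurableSet_mem_nodes hcard hpos hS
  have hfP : Measurable fun p => f (F.palmPoint S mark w p) := hf.comp hP
  rw [campbell, lintegral_map hf hP, ← lintegral_indicator hN,
    lintegral_prod _ (hfP.indicator hN).aemeasurable]
  refine lintegral_congr fun ω => ?_
  have : ∀ n, Set.indicator {p : Ω × ℕ | p.2 ∈ F.nodes S p.1}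
      (fun p => f (F.palmPoint S mark w p)) (ω, n) =
      Set.indicator (F.nodes S ω : Set ℕ) (fun n => f (F.palmPoint S mark w (ω, n))) n :=
    fun n => by simp [Set.indicator]
  simp only [this]
  rw [lintegral_indicator (F.nodes S ω).measurableSet, lintegral_finset]
  simp

theorem integral_campbell [SFinite μ] (hcard : Measurable F.card)
    (hpos : ∀ n, Measurable (F.pos n))
    (hS : MeasurableSet S) (hmark : ∀ n, Measurable (mark n)) (hw : Measurable w)
    {f : (Plane × T) × ℝ → ℂ} (hf : Measurable f) (hfi : Integrable f (F.campbell μ S mark w)) :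
    ∫ p, f p ∂(F.campbell μ S mark w) =
      ∫ ω, ∑ n ∈ F.nodes S ω, f (F.palmPoint S mark w (ω, n)) ∂μ := by
  have hP := measurable_palmPoint hcard hpos hS hmark hw
  have hN := measurableSet_mem_nodes hcard hpos hS
  rw [campbell, integrable_map_measure hf.aestronglyMeasurable hP.aemeasurable,
    ← IntegrableOn, ← integrable_indicator_iff hN, Function.comp_def] at hfi
  rw [campbell, integral_map hP.aemeasurable hf.aestronglyMeasurable, ← integral_indicator hN]
  rw [integral_prod _ hfi]
  refine integral_congr_ae (.of_forall fun ω => ?_)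
  have : ∀ n, Set.indicator {p : Ω × ℕ | p.2 ∈ F.nodes S p.1}
      (fun p => f (F.palmPoint S mark w p)) (ω, n) =
      Set.indicator (F.nodes S ω : Set ℕ) (fun n => f (F.palmPoint S mark w (ω, n))) n :=
    fun n => by simp [Set.indicator]
  simp only [this]
  rw [integral_indicator (F.nodes S ω).measurableSet, setIntegral_finset]
  · simp [measureReal_def]
  · refine ⟨(measurable_of_countable _).aestronglyMeasurable, ?_⟩
    rw [HasFiniteIntegral, lintegral_finset]
    simp [ENNReal.sum_lt_top]

/-- The total mass is the mean count, controlled by `N ≤ 2 ^ N`. Finiteness is what permits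
identification by characteristic functions. -/
theorem IsHomogeneousPPP.isFiniteMeasure_campbell [SFinite μ] (h : F.IsHomogeneousPPP μ A lam)
    (hSA : S ⊆ A) (hS : MeasurableSet S) (hmark : ∀ n, Measurable (mark n)) (hw : Measurable w) :
    IsFiniteMeasure (F.campbell μ S mark w) := by
  refine ⟨?_⟩
  rw [← lintegral_one, lintegral_campbell h.measurable_card h.measurable_pos hS hmark hw
    measurable_const]
  refine lt_of_le_of_lt (lintegral_mono fun ω => ?_) (h.integrable_pow_count hSA hS 2).2
  rw [Finset.sum_const, card_nodes, nsmul_one, enorm_pow]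
  have : ‖(2 : ℂ)‖ₑ = 2 := by
    rw [← ofReal_norm]; norm_num
  rw [this]
  have h2 : F.count S ω ≤ 2 ^ F.count S ω := Nat.lt_two_pow_self.le
  simpa using (Nat.cast_le (α := ENNReal)).2 h2

/-- Both sides have the same characteristic function: with `q = exp (i t w)` and `v` the indicator
of `E`, the multiplicative Campbell–Mecke formula is the mass of `E` times the generating functional
at `q`, which is the characteristic function of the shot noise. -/
theorem IsHomogeneousPPP.map_snd_campbell_restrict [IsProbabilityMeasure μ]
    (h : F.IsHomogeneousPPP μ A lam) (hM : F.IsIndepMarking μ mark κ) (hlam : 0 ≤ lam)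
    (hSA : S ⊆ A) (hS : MeasurableSet S) (hSfin : volume S ≠ ⊤) (hw : Measurable w)
    {E : Set (Plane × T)} (hE : MeasurableSet E) :
    ((F.campbell μ S mark w).restrict (E ×ˢ Set.univ)).map Prod.snd =
      (ENNReal.ofReal lam * ((volume.restrict S).prod κ) E) • μ.map (F.shotNoise S mark w) := by
  have hκ : IsProbabilityMeasure κ := by
    rw [← hM.map_mark 0]
    exact Measure.isProbabilityMeasure_map (hM.measurable_mark 0).aemeasurable
  have : IsFiniteMeasure (volume.restrict S) := isFiniteMeasure_restrict.2 hSfin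
  have := h.isFiniteMeasure_campbell hSA hS hM.measurable_mark hw
  have hshot := measurable_shotNoise h.measurable_card h.measurable_pos hS hM.measurable_mark hw
  have hc : ENNReal.ofReal lam * ((volume.restrict S).prod κ) E ≠ ⊤ :=
    ENNReal.mul_ne_top ENNReal.ofReal_ne_top (measure_ne_top _ _)
  have : IsFiniteMeasure ((ENNReal.ofReal lam * ((volume.restrict S).prod κ) E) •
      μ.map (F.shotNoise S mark w)) := Measure.smul_finite _ hc
  refine Measure.ext_of_charFun (funext fun t => ?_)
  have hEu : MeasurableSet (E ×ˢ (Set.univ : Set ℝ)) := hE.prod .univ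
  have hexp : Measurable fun y : ℝ => Complex.exp (t * y * Complex.I) := by fun_prop
  have hnorm : ∀ y : ℝ, ‖Complex.exp (t * y * Complex.I)‖ = 1 := fun y => by
    rw [← Complex.ofReal_mul, Complex.norm_exp_ofReal_mul_I]
  have hexp' : Measurable fun p : (Plane × T) × ℝ => Complex.exp (t * p.2 * Complex.I) := by
    fun_prop
  let q : Plane × T → ℂ := fun x => Complex.exp (t * w x * Complex.I)
  let v : Plane × T → ℂ := E.indicator 1
  have hq : Measurable q := hexp.comp hw
  have hv : Measurable v := measurable_one.indicator hE
  have hvb : ∀ x, ‖v x‖ ≤ 1 := fun x => by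
    simp only [v, Set.indicator]
    split_ifs <;> simp
  have hprod : ∀ s : Finset ℕ, ∀ ω, Complex.exp (t * ((∑ j ∈ s, w (F.pos j ω, mark j ω) : ℝ) : ℂ) *
      Complex.I) = ∏ j ∈ s, q (F.pos j ω, mark j ω) := fun s ω => by
    rw [← Complex.exp_sum, Complex.ofReal_sum, Finset.mul_sum, Finset.sum_mul]
  have hmass : ∫ x in S, ∫ s, v (x, s) ∂κ = (((volume.restrict S).prod κ).real E : ℂ) := by
    rw [← integral_prod v (.of_bound hv.aestronglyMeasurable 1 (.of_forall hvb))]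
    simp only [v]
    rw [integral_indicator hE]
    simp
  rw [charFun_apply_real, charFun_apply_real, integral_smul_measure,
    integral_map measurable_snd.aemeasurable hexp.aestronglyMeasurable,
    integral_map hshot.aemeasurable hexp.aestronglyMeasurable, ← integral_indicator hEu,
    integral_campbell h.measurable_card h.measurable_pos hS hM.measurable_mark hw
      (hexp'.indicator hEu)
      (.of_bound (hexp'.indicator hEu).aestronglyMeasurable 1
        (.of_forall fun p => (norm_indicator_le_norm_self _ _).trans (hnorm _).le))]
  simp only [shotNoise, hprod]
  rw [h.integral_prod_nodes hM hlam hSA hS hSfin hq (K := 1) (fun x => (hnorm _).le)]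
  have key := h.integral_sum_mul_prod_nodes_erase hM hlam hSA hS hSfin hq
    (fun x => (hnorm _).le) hv hvb
  rw [hmass] at key
  rw [ENNReal.toReal_mul, ENNReal.toReal_ofReal hlam, ← measureReal_def, Complex.real_smul,
    Complex.ofReal_mul, ← key]
  refine integral_congr_ae (.of_forall fun ω => Finset.sum_congr rfl fun n _ => ?_)
  simp only [palmPoint, reducedShotNoise, Set.indicator, Set.mem_prod, Set.mem_univ, and_true, v,
    Pi.one_apply, mul_ite, mul_one, mul_zero, hprod]
  by_cases hmem : (F.pos n ω, mark n ω) ∈ E <;> simp [hmem]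

/-- Slivnyak–Mecke: the remaining weight is independent of the point and its mark, and distributed
as the total weight. -/
theorem IsHomogeneousPPP.campbell_eq_prod [IsProbabilityMeasure μ]
    (h : F.IsHomogeneousPPP μ A lam) (hM : F.IsIndepMarking μ mark κ) (hlam : 0 ≤ lam)
    (hSA : S ⊆ A) (hS : MeasurableSet S) (hSfin : volume S ≠ ⊤) (hw : Measurable w) :
    F.campbell μ S mark w = (ENNReal.ofReal lam • (volume.restrict S).prod κ).prod
      (μ.map (F.shotNoise S mark w)) := by
  have hκ : IsProbabilityMeasure κ := by
    rw [← hM.map_mark 0]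
    exact Measure.isProbabilityMeasure_map (hM.measurable_mark 0).aemeasurable
  have : IsFiniteMeasure (volume.restrict S) := isFiniteMeasure_restrict.2 hSfin
  have : IsFiniteMeasure (ENNReal.ofReal lam • (volume.restrict S).prod κ) :=
    Measure.smul_finite _ ENNReal.ofReal_ne_top
  refine (Measure.prod_eq fun E C hE hC => ?_).symm
  have hr := congrArg (fun m => m C) (h.map_snd_campbell_restrict hM hlam hSA hS hSfin hw hE)
  simp only [Measure.smul_apply, smul_eq_mul] at hr ⊢
  rw [← hr, Measure.map_apply measurable_snd hC, Measure.restrict_apply (measurable_snd hC)]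
  congr 1
  ext p
  simp [and_comm]

end NodeField

/-! ### Derivatives of Laplace transforms and averages of Erlang tails. -/

theorem integrableExpSet_of_ae_nonneg {Q : Measure ℝ} [IsFiniteMeasure Q]
    (hQ : ∀ᵐ y ∂Q, 0 ≤ y) {s : ℝ} (hs : 0 < s) : -s ∈ interior (integrableExpSet id Q) := by
  have hsub : Set.Iic (0 : ℝ) ⊆ integrableExpSet id Q := fun t ht => by
    refine Integrable.of_bound (by fun_prop) 1 ?_
    filter_upwards [hQ] with y hy
    rw [Real.norm_of_nonneg (Real.exp_nonneg _), Real.exp_le_one_iff]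
    exact mul_nonpos_of_nonpos_of_nonneg ht hy
  refine interior_mono hsub ?_
  rw [interior_Iic]
  exact neg_lt_zero.2 hs

theorem iteratedDeriv_laplace {Q : Measure ℝ} [IsFiniteMeasure Q] (hQ : ∀ᵐ y ∂Q, 0 ≤ y)
    {L : ℝ → ℝ} (hL : ∀ s, 0 ≤ s → ∫ y, Real.exp (-s * y) ∂Q = L s) {s : ℝ} (hs : 0 < s) (k : ℕ) :
    iteratedDeriv k L s = (-1) ^ k * ∫ y, y ^ k * Real.exp (-s * y) ∂Q := by
  -- `L` is controlled only on the nonnegative half-line, hence `s > 0`: derivatives at `s` depend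
  -- only on a neighbourhood.
  have heq : L =ᶠ[nhds s] fun s => mgf id Q (-s) := by
    filter_upwards [Ioi_mem_nhds hs] with t ht
    rw [← hL t (le_of_lt ht), mgf]
    rfl
  rw [heq.iteratedDeriv_eq, iteratedDeriv_comp_neg,
    iteratedDeriv_mgf (integrableExpSet_of_ae_nonneg hQ hs)]
  rfl

/-- Each term `y ^ k * exp (-s y)` integrates to `(-1) ^ k` times a derivative of `L`; the sign is
absorbed into `(-s) ^ k`. -/
theorem integral_erlang_tail_eq {Q : Measure ℝ} [IsFiniteMeasure Q] (hQ : ∀ᵐ y ∂Q, 0 ≤ y)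
    {L : ℝ → ℝ} (hL : ∀ s, 0 ≤ s → ∫ y, Real.exp (-s * y) ∂Q = L s) {s : ℝ} (hs : 0 < s) (m : ℕ) :
    ∫ y, Real.exp (-(s * y)) * ∑ k ∈ Finset.range m, (s * y) ^ k / k.factorial ∂Q =
      ∑ k ∈ Finset.range m, (-s) ^ k / k.factorial * iteratedDeriv k L s := by
  have hint : ∀ k : ℕ, Integrable (fun y => y ^ k * Real.exp (-s * y)) Q := fun k =>
    integrable_pow_mul_exp_of_mem_interior_integrableExpSet
      (integrableExpSet_of_ae_nonneg hQ hs) k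
  have h1 : ∀ y : ℝ, Real.exp (-(s * y)) * ∑ k ∈ Finset.range m, (s * y) ^ k / k.factorial =
      ∑ k ∈ Finset.range m, s ^ k / k.factorial * (y ^ k * Real.exp (-s * y)) := fun y => by
    rw [Finset.mul_sum]
    refine Finset.sum_congr rfl fun k _ => ?_
    rw [mul_pow, neg_mul]
    ring
  simp only [h1]
  rw [integral_finsetSum _ fun k _ => (hint k).const_mul _]
  refine Finset.sum_congr rfl fun k _ => ?_
  rw [integral_const_mul, iteratedDeriv_laplace hQ hL hs, neg_pow]
  have : ((-1 : ℝ) ^ k) * (-1) ^ k = 1 := by rw [← mul_pow]; simp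
  linear_combination (-(s ^ k / k.factorial * ∫ y, y ^ k * Real.exp (-s * y) ∂Q)) * this

/-! ### From the disk to the distance from the drone. -/

/-- Substitution `r = √(ρ ^ 2 + h ^ 2)`, for which `r dr = ρ dρ`. -/
theorem integral_Ioc_comp_sqrt_sq_add_sq {h R : ℝ} (hh : 0 < h) (hR : 0 < R) (f : ℝ → ℝ) :
    ∫ r in h..Real.sqrt (h ^ 2 + R ^ 2), f r * r =
      ∫ ρ in Set.Ioc 0 R, ρ * f (Real.sqrt (ρ ^ 2 + h ^ 2)) := by
  have hle : h ≤ Real.sqrt (h ^ 2 + R ^ 2) := Real.le_sqrt_of_sq_le (by nlinarith)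
  have himage : (fun ρ : ℝ => Real.sqrt (ρ ^ 2 + h ^ 2)) '' Set.Ioc 0 R =
      Set.Ioc h (Real.sqrt (h ^ 2 + R ^ 2)) := by
    ext r
    constructor
    · rintro ⟨ρ, ⟨h0, hρ⟩, rfl⟩
      exact ⟨Real.lt_sqrt_of_sq_lt (by nlinarith), Real.sqrt_le_sqrt (by nlinarith)⟩
    · rintro ⟨h1, h2⟩
      have hr : 0 < r := hh.trans h1
      have h3 : r ^ 2 ≤ h ^ 2 + R ^ 2 := (Real.le_sqrt hr.le (by positivity)).1 h2
      refine ⟨Real.sqrt (r ^ 2 - h ^ 2), ⟨Real.sqrt_pos.2 (by nlinarith), ?_⟩, ?_⟩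
      · rw [Real.sqrt_le_left hR.le]
        linarith
      · simp only
        rw [Real.sq_sqrt (by nlinarith), sub_add_cancel, Real.sqrt_sq hr.le]
  have hderiv : ∀ ρ ∈ Set.Ioc (0 : ℝ) R, HasDerivWithinAt
      (fun ρ : ℝ => Real.sqrt (ρ ^ 2 + h ^ 2)) (ρ / Real.sqrt (ρ ^ 2 + h ^ 2)) (Set.Ioc 0 R) ρ := by
    intro ρ _
    have := ((hasDerivAt_pow 2 ρ).add_const (h ^ 2)).sqrt (by positivity)
    refine (this.congr_deriv ?_).hasDerivWithinAt
    have : 0 < Real.sqrt (ρ ^ 2 + h ^ 2) := by positivity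
    field_simp
    simp
  have hinj : Set.InjOn (fun ρ : ℝ => Real.sqrt (ρ ^ 2 + h ^ 2)) (Set.Ioc 0 R) := by
    intro x hx y hy hxy
    have h1 := (Real.sqrt_inj (by positivity) (by positivity)).1 hxy
    exact (pow_left_inj₀ hx.1.le hy.1.le two_ne_zero).1 (by linarith)
  rw [intervalIntegral.integral_of_le hle, ← himage,
    integral_image_eq_integral_abs_deriv_smul measurableSet_Ioc hderiv hinj]
  refine setIntegral_congr_fun measurableSet_Ioc fun ρ hρ => ?_
  have h0 : 0 < ρ := hρ.1
  have : 0 < Real.sqrt (ρ ^ 2 + h ^ 2) := by positivity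
  simp only [smul_eq_mul]
  rw [abs_of_nonneg (by positivity)]
  field_simp

theorem setIntegral_coverage_comp_droneDist {h R : ℝ} (hh : 0 < h) (hR : 0 < R) (c : Plane)
    (f : ℝ → ℝ) :
    ∫ x in NodeField.coverage c R, f (NodeField.droneDist c h x) =
      2 * Real.pi * ∫ r in h..Real.sqrt (h ^ 2 + R ^ 2), f r * r := by
  have h1 : ∫ x in NodeField.coverage c R, f (NodeField.droneDist c h x) =
      ∫ x : Plane, Set.indicator (Set.Iic R) (fun ρ => f (Real.sqrt (ρ ^ 2 + h ^ 2))) ‖x‖ := by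
    rw [NodeField.coverage, ← integral_indicator measurableSet_closedBall,
      ← integral_sub_right_eq_self (fun x : Plane =>
        Set.indicator (Set.Iic R) (fun ρ => f (Real.sqrt (ρ ^ 2 + h ^ 2))) ‖x‖) c]
    refine integral_congr_ae (.of_forall fun x => ?_)
    simp [Set.indicator, NodeField.droneDist, dist_eq_norm]
  have hvol : volume.real (Metric.ball (0 : Plane) 1) = Real.pi := by
    rw [measureReal_def, EuclideanSpace.volume_ball_fin_two]
    simp [Real.pi_nonneg]
  rw [h1, integral_fun_norm_addHaar volume, hvol, integral_Ioc_comp_sqrt_sq_add_sq hh hR,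
    finrank_euclideanSpace_fin, ← integral_indicator measurableSet_Ioc,
    ← integral_indicator measurableSet_Ioi, nsmul_eq_mul, smul_eq_mul]
  push_cast
  rw [mul_assoc]
  congr 3
  ext ρ
  simp only [Set.indicator, Set.mem_Ioi, Set.mem_Iic, Set.mem_Ioc, smul_eq_mul]
  by_cases h2 : 0 < ρ <;> by_cases h3 : ρ ≤ R <;> simp [h2, h3]

/-! ### ALOHA and Nakagami marks; the interference law and its Laplace transform. -/

/-- The law of a transmission decision. -/
noncomputable def alohaMeasure (a : ℝ) : Measure Bool :=
  ENNReal.ofReal a • Measure.dirac true + ENNReal.ofReal (1 - a) • Measure.dirac false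

theorem isProbabilityMeasure_alohaMeasure {a : ℝ} (ha0 : 0 ≤ a) (ha1 : a ≤ 1) :
    IsProbabilityMeasure (alohaMeasure a) := by
  refine ⟨?_⟩
  simp only [alohaMeasure, Measure.add_apply, Measure.smul_apply, measure_univ, smul_eq_mul,
    mul_one]
  rw [← ENNReal.ofReal_add ha0 (by linarith)]
  simp

theorem integral_alohaMeasure_prod {E : Type*} [NormedAddCommGroup E] [NormedSpace ℝ E]
    [CompleteSpace E] {a : ℝ} (ha0 : 0 ≤ a) (ha1 : a ≤ 1) {γ : Measure ℝ}
    [IsProbabilityMeasure γ] {f : Bool × ℝ → E} (hf : Integrable f ((alohaMeasure a).prod γ)) :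
    ∫ p, f p ∂((alohaMeasure a).prod γ) =
      a • ∫ g, f (true, g) ∂γ + (1 - a) • ∫ g, f (false, g) ∂γ := by
  have := isProbabilityMeasure_alohaMeasure ha0 ha1
  rw [integral_prod _ hf, alohaMeasure, integral_add_measure, integral_smul_measure,
    integral_smul_measure, integral_dirac, integral_dirac, ENNReal.toReal_ofReal ha0,
    ENNReal.toReal_ofReal (by linarith)]
  · exact (integrable_dirac (by simp)).smul_measure ENNReal.ofReal_ne_top
  · exact (integrable_dirac (by simp)).smul_measure ENNReal.ofReal_ne_top

theorem alohaMeasure_prod_true {a : ℝ} {γ : Measure ℝ} [IsProbabilityMeasure γ] (C : Set ℝ) :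
    ((alohaMeasure a).prod γ) ({true} ×ˢ C) = ENNReal.ofReal a * γ C := by
  rw [Measure.prod_prod]
  simp [alohaMeasure]

namespace NodeField

variable {Ω : Type*}

/-- The transmission decision and the gain of a node. -/
def alohaMark (F : NodeField Ω) (n : ℕ) (ω : Ω) : Bool × ℝ := (F.tx n ω, F.gain n ω)

/-- The received power of a node, normalized by the transmission power. -/
noncomputable def rxPower (c : Plane) (h η : ℝ) (p : Plane × (Bool × ℝ)) : ℝ :=
  if p.2.1 = true then p.2.2 * droneDist c h p.1 ^ (-η) else 0

theorem measurable_droneDist (c : Plane) (h : ℝ) : Measurable (droneDist c h) := by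
  unfold droneDist
  fun_prop

theorem droneDist_pos (c : Plane) {h : ℝ} (hh : 0 < h) (x : Plane) : 0 < droneDist c h x :=
  Real.sqrt_pos.2 (by positivity)

theorem measurable_rxPower (c : Plane) (h η : ℝ) : Measurable (rxPower c h η) := by
  unfold rxPower
  have := measurable_droneDist c h
  exact Measurable.ite (measurableSet_eq_fun (by fun_prop) measurable_const) (by fun_prop)
    measurable_const

theorem rxPower_nonneg {c : Plane} {h η : ℝ} (hh : 0 < h) {p : Plane × (Bool × ℝ)}
    (hp : 0 ≤ p.2.2) : 0 ≤ rxPower c h η p := by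
  unfold rxPower
  have := (droneDist_pos c hh p.1).le
  split_ifs
  · positivity
  · exact le_rfl

variable {F : NodeField Ω} {c : Plane} {R h η P noise : ℝ}

theorem active_eq_filter (B : Set Plane) (ω : Ω) :
    F.active B ω = (F.nodes B ω).filter (fun n => F.tx n ω = true) := by
  classical
  ext n
  simp [active, nodes, and_assoc]

theorem sum_active_erase (n : ℕ) (ω : Ω) :
    ∑ j ∈ (F.active (coverage c R) ω).erase n, F.gain j ω * droneDist c h (F.pos j ω) ^ (-η) =
      F.reducedShotNoise (coverage c R) F.alohaMark (rxPower c h η) n ω := by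
  classical
  rw [active_eq_filter, ← Finset.filter_erase, Finset.sum_filter]
  rfl

theorem interference_eq (n : ℕ) (ω : Ω) :
    F.interference c R h η P noise n ω =
      F.reducedShotNoise (coverage c R) F.alohaMark (rxPower c h η) n ω + noise / P := by
  rw [interference, sum_active_erase]

theorem sinr_eq (hP : 0 < P) (n : ℕ) (ω : Ω) :
    F.sinr c R h η P noise n ω = F.gain n ω * droneDist c h (F.pos n ω) ^ (-η) /
      F.interference c R h η P noise n ω := by
  have : (∑ j ∈ (F.active (coverage c R) ω).erase n,
      P * F.gain j ω * droneDist c h (F.pos j ω) ^ (-η)) + noise =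
      P * F.interference c R h η P noise n ω := by
    rw [interference, mul_add, Finset.mul_sum, mul_div_cancel₀ _ hP.ne']
    simp only [mul_assoc]
  rw [sinr, this, mul_assoc, mul_div_mul_left _ _ hP.ne']

variable [MeasurableSpace Ω] {μ : Measure Ω} {a : ℝ} {m : ℕ}

theorem HasAlohaNakagamiMarks.map_tx [IsProbabilityMeasure μ] (hF : F.HasAlohaNakagamiMarks μ a m)
    (ha0 : 0 ≤ a) (n : ℕ) : μ.map (F.tx n) = alohaMeasure a := by
  have htrue : μ.map (F.tx n) {true} = ENNReal.ofReal a := by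
    rw [Measure.map_apply (hF.measurable_tx n) (measurableSet_singleton _), ← hF.tx_prob n]
    rfl
  have := Measure.isProbabilityMeasure_map (μ := μ) (hF.measurable_tx n).aemeasurable
  refine Measure.ext_of_singleton fun b => ?_
  cases b
  · have : ({false} : Set Bool) = {true}ᶜ := by ext b; cases b <;> simp
    rw [this, prob_compl_eq_one_sub (measurableSet_singleton _), htrue, ← this]
    simp [alohaMeasure, ENNReal.ofReal_sub _ ha0]
  · rw [htrue]
    simp [alohaMeasure]

theorem HasAlohaNakagamiMarks.isIndepMarking [IsProbabilityMeasure μ]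
    (hF : F.HasAlohaNakagamiMarks μ a m) (ha0 : 0 ≤ a) :
    F.IsIndepMarking μ F.alohaMark ((alohaMeasure a).prod (gammaMeasure m m)) where
  measurable_mark n := (hF.measurable_tx n).prodMk (hF.measurable_gain n)
  map_mark n := by
    have := (indepFun_iff_map_prod_eq_prod_map_map (hF.measurable_tx n).aemeasurable
      (hF.measurable_gain n).aemeasurable).1 (hF.indep_tx_gain n)
    rw [hF.map_tx ha0, (hF.gain_law n).map_eq] at this
    exact this
  iIndep := hF.iIndep_marks
  indep_pos := hF.indep_pos_marks

theorem HasAlohaNakagamiMarks.ae_gain_nonneg (hF : F.HasAlohaNakagamiMarks μ a m) :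
    ∀ᵐ ω ∂μ, ∀ n, 0 ≤ F.gain n ω := by
  refine ae_all_iff.2 fun n => ?_
  have := gammaMeasure_ae_nonneg m m
  rw [← (hF.gain_law n).map_eq] at this
  exact ae_of_ae_map (hF.measurable_gain n).aemeasurable this

/-- The interference-plus-noise power of all transmitting nodes of the covered region. -/
noncomputable def interferenceLaw (F : NodeField Ω) (μ : Measure Ω) (c : Plane)
    (R h η P noise : ℝ) : Measure ℝ :=
  (μ.map (F.shotNoise (coverage c R) F.alohaMark (rxPower c h η))).map (· + noise / P)

variable {A : Set Plane} {lam : ℝ}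

theorem measurableSet_coverage (c : Plane) (R : ℝ) : MeasurableSet (coverage c R) :=
  measurableSet_closedBall

theorem volume_coverage_ne_top (c : Plane) (R : ℝ) : volume (coverage c R) ≠ ⊤ :=
  measure_closedBall_lt_top.ne

theorem measurable_alohaShotNoise (hPPP : F.IsHomogeneousPPP μ A lam)
    (hF : F.HasAlohaNakagamiMarks μ a m) :
    Measurable (F.shotNoise (coverage c R) F.alohaMark (rxPower c h η)) :=
  measurable_shotNoise hPPP.measurable_card hPPP.measurable_pos (measurableSet_coverage c R)
    (fun n => (hF.measurable_tx n).prodMk (hF.measurable_gain n)) (measurable_rxPower c h η)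

/-- A silent node contributes the factor `1`. Clipping the gain at `0` keeps the exponential bounded
by `1` everywhere. -/
theorem integral_exp_rxPower {γ : Measure ℝ} [IsProbabilityMeasure γ] (ha0 : 0 ≤ a) (ha1 : a ≤ 1)
    (hh : 0 < h) {s : ℝ} (hs : 0 ≤ s) (x : Plane) :
    ∫ t, Real.exp (-s * rxPower c h η (x, (t.1, max t.2 0))) ∂((alohaMeasure a).prod γ) =
      a * ∫ g, Real.exp (-(s * droneDist c h x ^ (-η)) * max g 0) ∂γ + (1 - a) := by
  have := isProbabilityMeasure_alohaMeasure ha0 ha1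
  have hmeas : Measurable fun t : Bool × ℝ => rxPower c h η (x, (t.1, max t.2 0)) :=
    (measurable_rxPower c h η).comp (by fun_prop)
  rw [integral_alohaMeasure_prod ha0 ha1]
  · have : ∀ g : ℝ, -s * (max g 0 * droneDist c h x ^ (-η)) =
        -(s * droneDist c h x ^ (-η)) * max g 0 := fun g => by ring
    simp [rxPower, this]
  · refine Integrable.of_bound (hmeas.const_mul _).exp.aestronglyMeasurable 1
      (.of_forall fun t => ?_)
    rw [Real.norm_of_nonneg (Real.exp_nonneg _), Real.exp_le_one_iff]
    exact mul_nonpos_of_nonpos_of_nonneg (neg_nonpos.2 hs) (rxPower_nonneg hh (le_max_right _ _))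

theorem integral_exp_neg_shotNoise [IsProbabilityMeasure μ] (hPPP : F.IsHomogeneousPPP μ A lam)
    (hF : F.HasAlohaNakagamiMarks μ a m) (hlam : 0 ≤ lam) (ha0 : 0 ≤ a) (ha1 : a ≤ 1)
    (hm : 1 ≤ m) (hh : 0 < h) (hcov : coverage c R ⊆ A) {s : ℝ} (hs : 0 ≤ s) :
    ∫ ω, Real.exp (-s * F.shotNoise (coverage c R) F.alohaMark (rxPower c h η) ω) ∂μ =
      Real.exp (-lam * a * ∫ x in coverage c R,
        (1 - (1 + s * droneDist c h x ^ (-η) / m) ^ (-(m : ℤ)))) := by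
  have hm0 : (0 : ℝ) < m := by exact_mod_cast hm
  have := isProbabilityMeasure_gammaMeasure hm0 hm0
  -- The generating functional needs a pointwise bound, whereas gains are nonnegative only almost
  -- surely; clipping changes nothing almost surely.
  let w' : Plane × (Bool × ℝ) → ℝ := fun p => rxPower c h η (p.1, (p.2.1, max p.2.2 0))
  have hw' : Measurable w' := (measurable_rxPower c h η).comp (by fun_prop)
  let u : Plane × (Bool × ℝ) → ℂ := fun p => ((Real.exp (-s * w' p) : ℝ) : ℂ)
  have hu : Measurable u := Complex.measurable_ofReal.comp (by fun_prop)
  have hub : ∀ p, ‖u p‖ ≤ 1 := fun p => by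
    rw [Complex.norm_real, Real.norm_of_nonneg (Real.exp_nonneg _), Real.exp_le_one_iff]
    exact mul_nonpos_of_nonpos_of_nonneg (neg_nonpos.2 hs) (rxPower_nonneg hh (le_max_right _ _))
  have hmean : ∀ x : Plane, ∫ t, u (x, t) ∂((alohaMeasure a).prod (gammaMeasure m m)) - 1 =
      ((-a * (1 - (1 + s * droneDist c h x ^ (-η) / m) ^ (-(m : ℤ))) : ℝ) : ℂ) := fun x => by
    have hD := (droneDist_pos c hh x).le
    rw [integral_complex_ofReal, integral_exp_rxPower ha0 ha1 hh hs, integral_congr_ae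
      (g := fun g => Real.exp (-(s * droneDist c h x ^ (-η)) * g)),
      integral_exp_neg_mul_gammaMeasure hm (by positivity)]
    · push_cast
      ring
    · filter_upwards [gammaMeasure_ae_nonneg m m] with g hg
      rw [max_eq_left hg]
  have key := hPPP.integral_prod_nodes (hF.isIndepMarking ha0) hlam hcov
    (measurableSet_coverage c R) (volume_coverage_ne_top c R) hu hub
  simp only [hmean] at key
  rw [integral_complex_ofReal, integral_const_mul] at key
  have hcast : ∫ ω, ∏ n ∈ F.nodes (coverage c R) ω, u (F.pos n ω, F.alohaMark n ω) ∂μ =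
      ((∫ ω, Real.exp (-s * F.shotNoise (coverage c R) F.alohaMark (rxPower c h η) ω) ∂μ : ℝ) :
        ℂ) := by
    rw [← integral_complex_ofReal]
    refine integral_congr_ae ?_
    filter_upwards [hF.ae_gain_nonneg] with ω hω
    rw [shotNoise, Finset.mul_sum, Real.exp_sum]
    push_cast
    refine Finset.prod_congr rfl fun n _ => ?_
    simp only [u, w', alohaMark, max_eq_left (hω n)]
    push_cast
    rfl
  rw [hcast, ← Complex.ofReal_mul, ← Complex.ofReal_exp, Complex.ofReal_inj] at key
  rw [key]
  congr 1
  ring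

theorem integral_exp_interferenceLaw [IsProbabilityMeasure μ]
    (hPPP : F.IsHomogeneousPPP μ A lam) (hF : F.HasAlohaNakagamiMarks μ a m) (hlam : 0 ≤ lam)
    (ha0 : 0 ≤ a) (ha1 : a ≤ 1) (hm : 1 ≤ m) (hh : 0 < h) (hR : 0 < R)
    (hcov : coverage c R ⊆ A) {s : ℝ} (hs : 0 ≤ s) :
    ∫ y, Real.exp (-s * y) ∂(F.interferenceLaw μ c R h η P noise) =
      laplaceI lam a η P noise h (Real.sqrt (h ^ 2 + R ^ 2)) m s := by
  have hshot := measurable_alohaShotNoise (c := c) (R := R) (h := h) (η := η) hPPP hF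
  rw [interferenceLaw, integral_map (by fun_prop) (by fun_prop),
    integral_map hshot.aemeasurable (by fun_prop)]
  simp only [mul_add, Real.exp_add]
  rw [integral_mul_const, integral_exp_neg_shotNoise hPPP hF hlam ha0 ha1 hm hh hcov hs,
    setIntegral_coverage_comp_droneDist hh hR c
      (fun r => 1 - (1 + s * r ^ (-η) / m) ^ (-(m : ℤ))), laplaceI, mul_comm, mul_div_assoc]
  congr 2
  ring

theorem isProbabilityMeasure_interferenceLaw [IsProbabilityMeasure μ]
    (hPPP : F.IsHomogeneousPPP μ A lam) (hF : F.HasAlohaNakagamiMarks μ a m) :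
    IsProbabilityMeasure (F.interferenceLaw μ c R h η P noise) := by
  have := Measure.isProbabilityMeasure_map (μ := μ)
    (measurable_alohaShotNoise (c := c) (R := R) (h := h) (η := η) hPPP hF).aemeasurable
  exact Measure.isProbabilityMeasure_map (by fun_prop)

theorem ae_shotNoise_nonneg (hPPP : F.IsHomogeneousPPP μ A lam)
    (hF : F.HasAlohaNakagamiMarks μ a m) (hh : 0 < h) :
    ∀ᵐ y ∂(μ.map (F.shotNoise (coverage c R) F.alohaMark (rxPower c h η))), 0 ≤ y := by
  refine (ae_map_iff (measurable_alohaShotNoise hPPP hF).aemeasurable measurableSet_Ici).2 ?_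
  filter_upwards [hF.ae_gain_nonneg] with ω hω
  exact Finset.sum_nonneg fun n _ => rxPower_nonneg hh (hω n)

theorem ae_interferenceLaw_nonneg (hPPP : F.IsHomogeneousPPP μ A lam)
    (hF : F.HasAlohaNakagamiMarks μ a m) (hh : 0 < h) (hP : 0 < P) (hnoise : 0 < noise) :
    ∀ᵐ y ∂(F.interferenceLaw μ c R h η P noise), 0 ≤ y := by
  rw [interferenceLaw]
  refine (ae_map_iff (by fun_prop) measurableSet_Ici).2 ?_
  filter_upwards [ae_shotNoise_nonneg hPPP hF hh] with y hy
  have : 0 < noise / P := by positivity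
  exact add_nonneg hy this.le

theorem isInterferenceLaw_interferenceLaw [IsProbabilityMeasure μ]
    (hPPP : F.IsHomogeneousPPP μ A lam) (hF : F.HasAlohaNakagamiMarks μ a m) (hlam : 0 ≤ lam)
    (ha0 : 0 ≤ a) (ha1 : a ≤ 1) (hm : 1 ≤ m) (hcov : coverage c R ⊆ A) :
    F.IsInterferenceLaw μ c R h η P noise (F.interferenceLaw μ c R h η P noise) := by
  classical
  refine ⟨isProbabilityMeasure_interferenceLaw hPPP hF, fun B C hB hC => ?_⟩
  have hm0 : (0 : ℝ) < m := by exact_mod_cast hm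
  have := isProbabilityMeasure_gammaMeasure hm0 hm0
  have := isProbabilityMeasure_alohaMeasure ha0 ha1
  have hM := hF.isIndepMarking ha0
  have hS := measurableSet_coverage c R
  have hshot := measurable_alohaShotNoise (c := c) (R := R) (h := h) (η := η) hPPP hF
  have hw := measurable_rxPower c h η
  have := Measure.isProbabilityMeasure_map (μ := μ) hshot.aemeasurable
  have hcamp := hPPP.campbell_eq_prod hM hlam hcov hS (volume_coverage_ne_top c R) hw
  let E : Set (Plane × (Bool × ℝ)) := {p | p.1 ∈ B ∧ p.2.1 = true}
  have hE : MeasurableSet E := (measurable_fst hB).inter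
    (measurableSet_eq_fun (by fun_prop) measurable_const)
  have hcount : ∀ C : Set ℝ, MeasurableSet C →
      ∫⁻ ω, (((F.active (coverage c R) ω).filter (fun n =>
        F.pos n ω ∈ B ∧ F.reducedShotNoise (coverage c R) F.alohaMark (rxPower c h η) n ω ∈ C)).card
          : ENNReal) ∂μ =
        F.campbell μ (coverage c R) F.alohaMark (rxPower c h η) (E ×ˢ C) := fun C hC => by
    rw [← lintegral_indicator_one (hE.prod hC), lintegral_campbell hPPP.measurable_card
      hPPP.measurable_pos hS hM.measurable_mark hw (measurable_one.indicator (hE.prod hC))]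
    refine lintegral_congr fun ω => ?_
    rw [active_eq_filter, Finset.filter_filter, Finset.card_filter, Nat.cast_sum]
    refine Finset.sum_congr rfl fun n _ => ?_
    simp only [Set.indicator, palmPoint, alohaMark, E, Set.mem_prod, Set.mem_ofPred_eq,
      Pi.one_apply]
    by_cases h1 : F.tx n ω = true <;> by_cases h2 : F.pos n ω ∈ B <;> simp [h1, h2]
  -- Adding the noise amounts to taking the preimage of `C` under a translation; the case of the
  -- whole line gives the normalizing mean count.
  have h1 := hcount _ (measurable_add_const (noise / P) hC)
  have h2 := hcount _ MeasurableSet.univ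
  simp only [Set.mem_univ, and_true] at h2
  simp only [Set.mem_preimage, ← interference_eq] at h1
  rw [h1, h2, hcamp, Measure.prod_prod, Measure.prod_prod, measure_univ, mul_one, interferenceLaw,
    Measure.map_apply (measurable_add_const _) hC]

end NodeField

/-! ### Successful transmissions: uniqueness and mean number. -/

namespace NodeField

variable {Ω : Type*} {F : NodeField Ω} {c : Plane} {R h η P noise β : ℝ}

theorem interference_pos (hh : 0 < h) (hP : 0 < P) (hnoise : 0 < noise) {ω : Ω}
    (hω : ∀ n, 0 ≤ F.gain n ω) (n : ℕ) : 0 < F.interference c R h η P noise n ω := by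
  have : 0 < noise / P := by positivity
  rw [interference_eq]
  exact add_pos_of_nonneg_of_pos (Finset.sum_nonneg fun j _ => rxPower_nonneg hh (hω j)) this

theorem le_sinr_iff (hh : 0 < h) (hP : 0 < P) (hnoise : 0 < noise) {ω : Ω}
    (hω : ∀ n, 0 ≤ F.gain n ω) (n : ℕ) :
    β ≤ F.sinr c R h η P noise n ω ↔
      β * F.interference c R h η P noise n ω ≤
        F.gain n ω * droneDist c h (F.pos n ω) ^ (-η) := by
  rw [sinr_eq hP, le_div_iff₀ (interference_pos hh hP hnoise hω n)]

/-- Isolating the node's own gain puts everything independent of it, its position and the reduced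
shot noise, on the other side. -/
theorem le_sinr_iff_le_gain (hh : 0 < h) (hP : 0 < P) (hnoise : 0 < noise) {ω : Ω}
    (hω : ∀ n, 0 ≤ F.gain n ω) (n : ℕ) :
    β ≤ F.sinr c R h η P noise n ω ↔
      β * droneDist c h (F.pos n ω) ^ η * F.interference c R h η P noise n ω ≤ F.gain n ω := by
  have hD := Real.rpow_pos_of_pos (droneDist_pos c hh (F.pos n ω)) η
  rw [le_sinr_iff hh hP hnoise hω, Real.rpow_neg (droneDist_pos c hh _).le, ← div_eq_mul_inv,
    le_div_iff₀ hD, mul_right_comm]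

/-- For a threshold at least `1`, at most one transmission succeeds. -/
theorem eq_of_le_sinr (hβ : 1 ≤ β) (hh : 0 < h) (hP : 0 < P) (hnoise : 0 < noise) {ω : Ω}
    (hω : ∀ n, 0 ≤ F.gain n ω) {n k : ℕ} (hn : n ∈ F.active (coverage c R) ω)
    (hk : k ∈ F.active (coverage c R) ω) (hns : β ≤ F.sinr c R h η P noise n ω)
    (hks : β ≤ F.sinr c R h η P noise k ω) : n = k := by
  by_contra hne
  -- If `i` succeeds and `β ≥ 1`, its received power is at least its interference plus noise, which
  -- contains the power of `j` and a strictly positive noise. Exchanging the roles gives the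
  -- contradiction.
  have key : ∀ i j : ℕ, i ≠ j → j ∈ F.active (coverage c R) ω →
      β ≤ F.sinr c R h η P noise i ω →
      F.gain j ω * droneDist c h (F.pos j ω) ^ (-η) <
        F.gain i ω * droneDist c h (F.pos i ω) ^ (-η) := fun i j hij hj hi => by
    have h1 := (le_sinr_iff hh hP hnoise hω i).1 hi
    have hI := interference_pos (c := c) (R := R) (η := η) hh hP hnoise hω i
    have h2 : F.gain j ω * droneDist c h (F.pos j ω) ^ (-η) ≤
        ∑ l ∈ (F.active (coverage c R) ω).erase i,
          F.gain l ω * droneDist c h (F.pos l ω) ^ (-η) :=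
      Finset.single_le_sum
        (f := fun l => F.gain l ω * droneDist c h (F.pos l ω) ^ (-η))
        (fun l _ => mul_nonneg (hω l) (Real.rpow_nonneg (droneDist_pos c hh _).le _))
        (Finset.mem_erase.2 ⟨hij.symm, hj⟩)
    have h3 : 0 < noise / P := by positivity
    have h4 : F.interference c R h η P noise i ω ≤ β * F.interference c R h η P noise i ω :=
      le_mul_of_one_le_left hI.le hβ
    have h5 : F.interference c R h η P noise i ω =
      (∑ l ∈ (F.active (coverage c R) ω).erase i,
          F.gain l ω * droneDist c h (F.pos l ω) ^ (-η)) + noise / P := rfl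
    linarith
  exact lt_asymm (key n k hne hk hns) (key k n (Ne.symm hne) hn hks)

theorem successCount_eq_indicator (hβ : 1 ≤ β) (hh : 0 < h) (hP : 0 < P) (hnoise : 0 < noise)
    {ω : Ω} (hω : ∀ n, 0 ≤ F.gain n ω) :
    F.successCount c R h η P noise β ω =
      (F.successEvent c R h η P noise β).indicator 1 ω := by
  classical
  by_cases hs : ω ∈ F.successEvent c R h η P noise β
  · have ⟨n, hn, hns⟩ : ∃ n ∈ F.active (coverage c R) ω, β ≤ F.sinr c R h η P noise n ω := hs
    rw [Set.indicator_of_mem hs, successCount, Finset.sum_eq_single n]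
    · simp [hns]
    · intro k hk hkn
      exact if_neg fun hks => hkn (eq_of_le_sinr hβ hh hP hnoise hω hk hn hks hns)
    · exact fun h => absurd hn h
  · rw [Set.indicator_of_notMem hs, successCount]
    exact Finset.sum_eq_zero fun n hn => if_neg fun hns => hs ⟨n, hn, hns⟩

/-- Position, mark and interference of a node whose transmission succeeds. -/
def successRegion (c : Plane) (h η P noise β : ℝ) : Set ((Plane × (Bool × ℝ)) × ℝ) :=
  {p | p.1.2.1 = true ∧ β * droneDist c h p.1.1 ^ η * (p.2 + noise / P) ≤ p.1.2.2}

theorem measurableSet_successRegion : MeasurableSet (successRegion c h η P noise β) := by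
  have := measurable_droneDist c h
  have h1 : Measurable fun p : (Plane × (Bool × ℝ)) × ℝ => p.1.2.1 := by fun_prop
  have h2 : Measurable fun p : (Plane × (Bool × ℝ)) × ℝ =>
      β * droneDist c h p.1.1 ^ η * (p.2 + noise / P) := by fun_prop
  have h3 : Measurable fun p : (Plane × (Bool × ℝ)) × ℝ => p.1.2.2 := by fun_prop
  exact (measurableSet_eq_fun h1 measurable_const).inter (measurableSet_le h2 h3)

theorem successCount_eq_toReal_sum (hh : 0 < h) (hP : 0 < P) (hnoise : 0 < noise)
    {ω : Ω} (hω : ∀ n, 0 ≤ F.gain n ω) :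
    F.successCount c R h η P noise β ω =
      (∑ n ∈ F.nodes (coverage c R) ω, (successRegion c h η P noise β).indicator
        (1 : (Plane × (Bool × ℝ)) × ℝ → ENNReal)
        (F.palmPoint (coverage c R) F.alohaMark (rxPower c h η) (ω, n))).toReal := by
  classical
  rw [successCount, active_eq_filter, Finset.sum_filter, ENNReal.toReal_sum fun n _ => by
    simp only [Set.indicator]; split_ifs <;> simp]
  refine Finset.sum_congr rfl fun n _ => ?_
  simp only [le_sinr_iff_le_gain hh hP hnoise hω, interference_eq, Set.indicator, successRegion,
    palmPoint, alohaMark, Set.mem_ofPred_eq, Pi.one_apply]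
  by_cases h1 : F.tx n ω = true
  · simp only [h1, true_and, if_true]
    split_ifs <;> simp
  · simp [h1]

variable [MeasurableSpace Ω] {μ : Measure Ω} {A : Set Plane} {a lam : ℝ} {m : ℕ}

theorem measurable_measure_Ici (γ : Measure ℝ) : Measurable fun v => γ (Set.Ici v) :=
  Antitone.measurable fun _ _ h => measure_mono (Set.Ici_subset_Ici.2 h)

/-- Under the product form, fixing position and interference leaves a set of marks of mass `a` times
a gamma tail; the noise shift is then absorbed into `interferenceLaw`. -/
theorem campbell_successRegion [IsProbabilityMeasure μ] (hPPP : F.IsHomogeneousPPP μ A lam)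
    (hF : F.HasAlohaNakagamiMarks μ a m) (hlam : 0 ≤ lam) (ha0 : 0 ≤ a) (ha1 : a ≤ 1)
    (hm : 1 ≤ m) (hcov : coverage c R ⊆ A) :
    F.campbell μ (coverage c R) F.alohaMark (rxPower c h η) (successRegion c h η P noise β) =
      ENNReal.ofReal lam * (ENNReal.ofReal a * ∫⁻ x in coverage c R,
        ∫⁻ y, gammaMeasure m m (Set.Ici (β * droneDist c h x ^ η * y))
          ∂(F.interferenceLaw μ c R h η P noise)) := by
  have hm0 : (0 : ℝ) < m := by exact_mod_cast hm
  have := isProbabilityMeasure_gammaMeasure hm0 hm0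
  have := isProbabilityMeasure_alohaMeasure ha0 ha1
  have hS := measurableSet_coverage c R
  have hE := measurableSet_successRegion (c := c) (h := h) (η := η) (P := P) (noise := noise)
    (β := β)
  have hshot := measurable_alohaShotNoise (c := c) (R := R) (h := h) (η := η) hPPP hF
  have := Measure.isProbabilityMeasure_map (μ := μ) hshot.aemeasurable
  have := measurable_droneDist c h
  have hIci := measurable_measure_Ici (gammaMeasure m m)
  have hmeas : Measurable fun p : ℝ × Plane =>
      gammaMeasure m m (Set.Ici (β * droneDist c h p.2 ^ η * (p.1 + noise / P))) :=
    hIci.comp (by fun_prop)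
  have hmeas1 : ∀ y : ℝ, Measurable fun x : Plane =>
      gammaMeasure m m (Set.Ici (β * droneDist c h x ^ η * (y + noise / P))) := fun y =>
    hIci.comp (by fun_prop)
  have hmeas2 : ∀ x : Plane, Measurable fun y : ℝ =>
      gammaMeasure m m (Set.Ici (β * droneDist c h x ^ η * y)) := fun x =>
    hIci.comp (by fun_prop)
  have hsec : ∀ (x : Plane) (y : ℝ), ((alohaMeasure a).prod (gammaMeasure m m))
      (Prod.mk x ⁻¹' ((fun z => (z, y)) ⁻¹' successRegion c h η P noise β)) =
      ENNReal.ofReal a * gammaMeasure m m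
        (Set.Ici (β * droneDist c h x ^ η * (y + noise / P))) := fun x y => by
    rw [← alohaMeasure_prod_true]
    congr 1
  rw [hPPP.campbell_eq_prod (hF.isIndepMarking ha0) hlam hcov hS (volume_coverage_ne_top c R)
    (measurable_rxPower c h η), Measure.prod_apply_symm hE]
  have hsec2 : ∀ y : ℝ, (ENNReal.ofReal lam • (volume.restrict (coverage c R)).prod
      ((alohaMeasure a).prod (gammaMeasure m m)))
      ((fun z => (z, y)) ⁻¹' successRegion c h η P noise β) =
      ENNReal.ofReal lam * (ENNReal.ofReal a * ∫⁻ x in coverage c R, gammaMeasure m m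
        (Set.Ici (β * droneDist c h x ^ η * (y + noise / P)))) := fun y => by
    rw [Measure.smul_apply, smul_eq_mul, Measure.prod_apply (measurable_prodMk_right hE)]
    simp only [hsec]
    rw [lintegral_const_mul _ (hmeas1 y)]
  simp only [hsec2]
  rw [lintegral_const_mul _ (hmeas.lintegral_prod_right'.const_mul _),
    lintegral_const_mul _ hmeas.lintegral_prod_right',
    lintegral_lintegral_swap hmeas.aemeasurable]
  congr 2
  refine lintegral_congr fun x => ?_
  rw [interferenceLaw, lintegral_map (hmeas2 x) (by fun_prop)]

theorem campbell_real_successRegion [IsProbabilityMeasure μ] (hPPP : F.IsHomogeneousPPP μ A lam)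
    (hF : F.HasAlohaNakagamiMarks μ a m) (hlam : 0 ≤ lam) (ha0 : 0 ≤ a) (ha1 : a ≤ 1)
    (hm : 1 ≤ m) (hcov : coverage c R ⊆ A) :
    (F.campbell μ (coverage c R) F.alohaMark (rxPower c h η)).real
        (successRegion c h η P noise β) =
      lam * (a * ∫ x in coverage c R,
        ∫ y, (gammaMeasure m m).real (Set.Ici (β * droneDist c h x ^ η * y))
          ∂(F.interferenceLaw μ c R h η P noise)) := by
  have hm0 : (0 : ℝ) < m := by exact_mod_cast hm
  have := isProbabilityMeasure_gammaMeasure hm0 hm0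
  have := isProbabilityMeasure_interferenceLaw (c := c) (R := R) (h := h) (η := η) (P := P)
    (noise := noise) hPPP hF
  have := measurable_droneDist c h
  have hIci := measurable_measure_Ici (gammaMeasure m m)
  have hmeas : Measurable fun p : Plane × ℝ =>
      gammaMeasure m m (Set.Ici (β * droneDist c h p.1 ^ η * p.2)) :=
    hIci.comp (by fun_prop)
  rw [measureReal_def, campbell_successRegion hPPP hF hlam ha0 ha1 hm hcov, ENNReal.toReal_mul,
    ENNReal.toReal_mul, ENNReal.toReal_ofReal hlam, ENNReal.toReal_ofReal ha0,
    ← integral_toReal hmeas.lintegral_prod_right'.aemeasurable]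
  · congr 2
    refine integral_congr_ae (.of_forall fun x => ?_)
    exact (integral_toReal (hmeas.comp measurable_prodMk_left).aemeasurable
      (.of_forall fun y => measure_lt_top _ _)).symm
  · refine .of_forall fun x => ?_
    refine (lintegral_mono (g := fun _ => 1) fun y => prob_le_one).trans_lt ?_
    simp

theorem integral_gammaMeasure_real_Ici [IsProbabilityMeasure μ]
    (hPPP : F.IsHomogeneousPPP μ A lam) (hF : F.HasAlohaNakagamiMarks μ a m) (hlam : 0 ≤ lam)
    (ha0 : 0 ≤ a) (ha1 : a ≤ 1) (hβ : 0 < β) (hP : 0 < P) (hnoise : 0 < noise) (hm : 1 ≤ m)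
    (hh : 0 < h) (hR : 0 < R) (hcov : coverage c R ⊆ A) {r : ℝ} (hr : 0 < r) :
    ∫ y, (gammaMeasure m m).real (Set.Ici (β * r ^ η * y))
        ∂(F.interferenceLaw μ c R h η P noise) =
      ∑ k ∈ Finset.range m, (-(m * β * r ^ η)) ^ k / (k.factorial : ℝ) *
        iteratedDeriv k (laplaceI lam a η P noise h (Real.sqrt (h ^ 2 + R ^ 2)) m)
          (m * β * r ^ η) := by
  have hm0 : (0 : ℝ) < m := by exact_mod_cast hm
  have := isProbabilityMeasure_interferenceLaw (c := c) (R := R) (h := h) (η := η) (P := P)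
    (noise := noise) hPPP hF
  have hQ := ae_interferenceLaw_nonneg (c := c) (R := R) (η := η) hPPP hF hh hP hnoise
  rw [← integral_erlang_tail_eq hQ
    (fun s hs => integral_exp_interferenceLaw hPPP hF hlam ha0 ha1 hm hh hR hcov hs)
    (by positivity) m]
  refine integral_congr_ae ?_
  filter_upwards [hQ] with y hy
  rw [gammaMeasure_real_Ici hm (by positivity)]
  simp only [mul_assoc]

end NodeField

/-! ### The success probability. -/

theorem theorem1 {Ω : Type*} [MeasurableSpace Ω] (μ : Measure Ω) [IsProbabilityMeasure μ]
    (F : NodeField Ω) (A : Set Plane) (c : Plane) (lam a β η P noise h R d : ℝ) (m : ℕ)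
    (hlam : 0 < lam) (ha0 : 0 ≤ a) (ha1 : a ≤ 1) (hβ : 1 ≤ β) (hη : 0 < η) (hP : 0 < P)
    (hnoise : 0 < noise) (hh : 0 < h) (hR : 0 < R) (hm : 1 ≤ m)
    (hd : d = Real.sqrt (h ^ 2 + R ^ 2))
    (hA : MeasurableSet A) (hAfin : volume A ≠ ⊤) (hcov : NodeField.coverage c R ⊆ A)
    (hPPP : F.IsHomogeneousPPP μ A lam) (hmarks : F.HasAlohaNakagamiMarks μ a m) :
    Integrable (F.successCount c R h η P noise β) μ ∧
    μ.real (F.successEvent c R h η P noise β) = ∫ ω, F.successCount c R h η P noise β ω ∂μ ∧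
    μ.real (F.successEvent c R h η P noise β) =
      2 * a * Real.pi * lam * ∫ r in h..d,
        (∑ k ∈ Finset.range m, (-(m * β * r ^ η)) ^ k / (k.factorial : ℝ) *
          iteratedDeriv k (laplaceI lam a η P noise h d m) (m * β * r ^ η)) * r ∧
    ∃ Q : Measure ℝ, F.IsInterferenceLaw μ c R h η P noise Q ∧
      ∀ s : ℝ, 0 ≤ s → ∫ y, Real.exp (-s * y) ∂Q = laplaceI lam a η P noise h d m s := by
  subst hd
  have hS := NodeField.measurableSet_coverage c R
  have hM := hmarks.isIndepMarking ha0
  have hw := NodeField.measurable_rxPower c h η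
  have hE := NodeField.measurableSet_successRegion (c := c) (h := h) (η := η) (P := P)
    (noise := noise) (β := β)
  have hfin := hPPP.isFiniteMeasure_campbell hcov hS hM.measurable_mark hw
  let N : Ω → ENNReal := fun ω => ∑ n ∈ F.nodes (NodeField.coverage c R) ω,
    (NodeField.successRegion c h η P noise β).indicator (1 : (Plane × (Bool × ℝ)) × ℝ → ENNReal)
      (F.palmPoint (NodeField.coverage c R) F.alohaMark (NodeField.rxPower c h η) (ω, n))
  have hN : Measurable N := NodeField.measurable_sum_nodes hPPP.measurable_card
    hPPP.measurable_pos hS fun n => (measurable_one.indicator hE).comp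
      ((NodeField.measurable_palmPoint hPPP.measurable_card hPPP.measurable_pos hS
        hM.measurable_mark hw).comp measurable_prodMk_right)
  have hlint : ∫⁻ ω, N ω ∂μ = F.campbell μ (NodeField.coverage c R) F.alohaMark
      (NodeField.rxPower c h η) (NodeField.successRegion c h η P noise β) := by
    rw [← lintegral_indicator_one hE, NodeField.lintegral_campbell hPPP.measurable_card
      hPPP.measurable_pos hS hM.measurable_mark hw (measurable_one.indicator hE)]
  have hNfin : ∫⁻ ω, N ω ∂μ ≠ ⊤ := hlint ▸ measure_ne_top _ _
  have hcount : F.successCount c R h η P noise β =ᵐ[μ] fun ω => (N ω).toReal := by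
    filter_upwards [hmarks.ae_gain_nonneg] with ω hω
    exact NodeField.successCount_eq_toReal_sum hh hP hnoise hω
  have hind : F.successCount c R h η P noise β =ᵐ[μ]
      (F.successEvent c R h η P noise β).indicator 1 := by
    filter_upwards [hmarks.ae_gain_nonneg] with ω hω
    exact NodeField.successCount_eq_indicator hβ hh hP hnoise hω
  -- Null measurability suffices: the event agrees almost surely with `N = 1`, where `N` is a
  -- measurable success count.
  have hnull : NullMeasurableSet (F.successEvent c R h η P noise β) μ := by
    classical
    refine (hN.ennreal_toReal (measurableSet_singleton 1)).nullMeasurableSet.congr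
      (Filter.eventuallyEq_set.2 ?_)
    filter_upwards [hcount, hind] with ω h1 h2
    rw [Set.mem_preimage, Set.mem_singleton_iff, ← h1, h2, Set.indicator_apply]
    split_ifs with h3 <;> simp [h3]
  have hprob : μ.real (F.successEvent c R h η P noise β) =
      ∫ ω, F.successCount c R h η P noise β ω ∂μ := by
    rw [integral_congr_ae hind, integral_indicator₀ hnull]
    simp
  refine ⟨(integrable_toReal_of_lintegral_ne_top hN.aemeasurable hNfin).congr hcount.symm, hprob,
    ?_, _, NodeField.isInterferenceLaw_interferenceLaw hPPP hmarks hlam.le ha0 ha1 hm hcov,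
    fun s hs => NodeField.integral_exp_interferenceLaw hPPP hmarks hlam.le ha0 ha1 hm hh hR hcov
      hs⟩
  rw [hprob, integral_congr_ae hcount, integral_toReal hN.aemeasurable
    (ae_lt_top hN hNfin), hlint, ← measureReal_def,
    NodeField.campbell_real_successRegion hPPP hmarks hlam.le ha0 ha1 hm hcov]
  simp only [NodeField.integral_gammaMeasure_real_Ici hPPP hmarks hlam.le ha0 ha1
    (one_pos.trans_le hβ) hP hnoise hm hh hR hcov (NodeField.droneDist_pos c hh _)]
  rw [setIntegral_coverage_comp_droneDist hh hR c (fun r =>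
    ∑ k ∈ Finset.range m, (-(m * β * r ^ η)) ^ k / (k.factorial : ℝ) *
      iteratedDeriv k (laplaceI lam a η P noise h (Real.sqrt (h ^ 2 + R ^ 2)) m)
        (m * β * r ^ η))]
  ring
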